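/- **Conventions.** Graphs are simple (no loops, no multiple edges). A *generalised simplicial complex* $K$ (regular $\Delta$-complex) in a Euclidean space $\mathbb R^N$ is given by finitely many cells (also called simplices), each the image of a standard simplex under an injective continuous characteristic map, such that the image of every open face of a cell is the interior of a cell of the same dimension, and the interiors of distinct cells are disjoint; distinct cells may have the same vertex set. The polyhedron $\|K\|$ is the union of the cells, and $K$ triangulates any space homeomorphic to $\|K\|$. A *quadrangulation of $K$* is a spanning subgraph of the $1$-skeleton of $K$ such that its edges contained in any inclusionwise maximal simplex $\sigma$ form a complete bipartite graph with at least one edge on the vertex set of $\sigma$. A graph $G$ is a *quadrangulation of a space $X$* if it is isomorphic to a quadrangulation of some $K$ with $\|K\|$ homeomorphic to $X$. Let $P^n$ be the $n$-dimensional real projective space, the quotient of the unit sphere $S^n\subset\mathbb R^{n+1}$ by $x\sim -x$, and let $B^n\subset\mathbb R^n$ be the closed unit ball. A triangulation $T$ with $\|T\|=S^n$ is *symmetric* if $-\sigma$ is a cell of $T$ for each cell $\sigma$ of $T$. A triangulation $T'$ with $\|T'\|=B^n$ is *boundary-symmetric* if the cells of $T'$ contained in $\partial B^n=S^{n-1}$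 form a symmetric triangulation of $S^{n-1}$. A $2$-colouring of (the vertices of) a complex is *proper* if no maximal simplex is monochromatic; it is *antisymmetric* (respectively *boundary-antisymmetric*) if any two antipodal vertices (respectively any two antipodal boundary vertices) have different colours. Its *associated graph* is the spanning subgraph of the $1$-skeleton formed by all edges whose ends have different colours. When antipodal (boundary) vertices are identified, antipodal edges (of the boundary) are identified with them. **Lemma.** Let $n\ge 0$. For a graph $G$, consider the following statements. (a) $G$ is a non-bipartite quadrangulation of $P^n$. (b) There is a symmetric triangulation $T$ of $S^n$ such that no simplex of $T$ contains antipodal vertices, and a proper antisymmetric $2$-colouring of $T$ such that $G$ is (up to isomorphism) obtained from the associated graph by identifying all pairs of antipodal vertices. (c) There is a boundary-symmetric triangulation $T'$ of $B^n$ such that no simplex of $T'$ contains antipodal boundary vertices, and a proper boundary-antisymmetric $2$-colouring of $T'$ such that $G$ is (up to isomorphism) obtained from the associated graph by identifying all pairs of antipodal boundary vertices. Then (a) and (b) are equivalent, and (c) implies both of them. Since $1$-skeletons may have parallel edges, the lemma is asserted under each of the following two conventions, applied uniformly to (a), (b) and (c): either the subgraph of the $1$-skeleton in (a), and the result of the identification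 in (b) and (c), are required to have no parallel edges, or their parallel edges are merged to obtain the simple graph $G$. -/

import Mathlib

open scoped Pointwise

/-- The open face, spanned by the vertices in `S`, of the standard `d`-simplex: the points whose
barycentric coordinates are positive exactly on `S`. -/
def simplexOpenFace {d : ℕ} (S : Finset (Fin (d + 1))) : Set (stdSimplex ℝ (Fin (d + 1))) :=
  {x | ∀ i, 0 < x.1 i ↔ i ∈ S}

/-- A finite generalised simplicial complex (regular `Δ`-complex) in a space `X`: finitely many
cells, each an injectively embedded simplex, such that every open face of a cell is the open
simplex of a cell of the same dimension, and the open simplices of distinct cells are disjoint.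
Different cells may have the same set of vertices. -/
structure GenSimplicialComplex (X : Type*) [TopologicalSpace X] where
  Cell : Type
  finite_cell : Finite Cell
  dim : Cell → ℕ
  char : ∀ s : Cell, stdSimplex ℝ (Fin (dim s + 1)) → X
  continuous_char : ∀ s, Continuous (char s)
  injective_char : ∀ s, Function.Injective (char s)
  exists_face : ∀ (s : Cell) (S : Finset (Fin (dim s + 1))), S.Nonempty →
    ∃ t : Cell, dim t + 1 = S.card ∧
      char t '' simplexOpenFace Finset.univ = char s '' simplexOpenFace S
  disjoint_openCell : ∀ s t : Cell, s ≠ t →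
    Disjoint (char s '' simplexOpenFace Finset.univ) (char t '' simplexOpenFace Finset.univ)

namespace GenSimplicialComplex

variable {X : Type*} [TopologicalSpace X] (K : GenSimplicialComplex X)

/-- The closed cell (face, simplex) indexed by `s`, as a subset of the ambient space. -/
def closedCell (s : K.Cell) : Set X := Set.range (K.char s)

/-- The polyhedron of the complex: the union of all its cells. -/
def polyhedron : Set X := ⋃ s : K.Cell, K.closedCell s

/-- The vertices of the complex, as points of the ambient space. -/
def vertices : Set X := {x | ∃ s : K.Cell, K.dim s = 0 ∧ x ∈ K.closedCell s}

/-- The edges of the `1`-skeleton, which in general is a multigraph. -/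
def Edge : Type := {e : K.Cell // K.dim e = 1}

/-- The `1`-simplex `e` joins the vertices `u` and `v`. -/
def Joins (e : K.Edge) (u v : K.vertices) : Prop :=
  u ≠ v ∧ (u : X) ∈ K.closedCell e.1 ∧ (v : X) ∈ K.closedCell e.1

/-- The cell `s` is inclusionwise maximal. -/
def IsMaximalCell (s : K.Cell) : Prop :=
  ∀ t : K.Cell, K.closedCell s ⊆ K.closedCell t → t = s

/-- The graph spanned by a set `F` of edges on the set of all vertices of the complex. -/
def edgeGraph (F : Set K.Edge) : SimpleGraph K.vertices where
  Adj u v := ∃ e ∈ F, K.Joins e u v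
  symm := ⟨fun _ _ ⟨e, he, h⟩ => ⟨e, he, h.1.symm, h.2.2, h.2.1⟩⟩
  loopless := ⟨fun _ ⟨_, _, h⟩ => h.1 rfl⟩

/-- The graph on the vertices of the cell `s` whose edges are the elements of `F` that are
faces of `s`. -/
def cellGraph (F : Set K.Edge) (s : K.Cell) :
    SimpleGraph {v : K.vertices // (v : X) ∈ K.closedCell s} where
  Adj u v := ∃ e ∈ F, K.closedCell e.1 ⊆ K.closedCell s ∧ K.Joins e u.1 v.1
  symm := ⟨fun _ _ ⟨e, he, hs, h⟩ => ⟨e, he, hs, h.1.symm, h.2.2, h.2.1⟩⟩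
  loopless := ⟨fun _ ⟨_, _, _, h⟩ => h.1 rfl⟩

/-- The set `F` of edges spans a quadrangulation of the complex: in every maximal cell it
cuts out a complete bipartite graph with at least one edge. -/
def IsQuadrangulation (F : Set K.Edge) : Prop :=
  ∀ s : K.Cell, K.IsMaximalCell s →
    ∃ A : Set {v : K.vertices // (v : X) ∈ K.closedCell s},
      A.Nonempty ∧ Aᶜ.Nonempty ∧ ∀ u v, (K.cellGraph F s).Adj u v ↔ (u ∈ A ↔ v ∉ A)

/-- A `2`-colouring is proper if there is no monochromatic maximal simplex. -/
def IsProperColouring (c : K.vertices → Bool) : Prop :=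
  ∀ s : K.Cell, K.IsMaximalCell s →
    ∃ u v : K.vertices, (u : X) ∈ K.closedCell s ∧ (v : X) ∈ K.closedCell s ∧ c u ≠ c v

/-- The edges of the graph associated to a `2`-colouring: those with ends of both colours. -/
def bichromaticEdges (c : K.vertices → Bool) : Set K.Edge :=
  {e | ∃ u v : K.vertices, K.Joins e u v ∧ c u ≠ c v}

end GenSimplicialComplex

/-- The two possible conventions for parallel edges in a graph drawn in a generalised simplicial
complex: either they must not occur, or they are merged into a single edge. -/
inductive ParallelEdges
  | forbidden
  | merged

/-- The simple graph `G` is (isomorphic to) a quadrangulation of the topological space `Y`. -/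
def IsQuadrangulationOf (conv : ParallelEdges) {V : Type*} (G : SimpleGraph V)
    (Y : Type*) [TopologicalSpace Y] : Prop :=
  ∃ (N : ℕ) (K : GenSimplicialComplex (EuclideanSpace ℝ (Fin N))) (F : Set K.Edge),
    Nonempty (K.polyhedron ≃ₜ Y) ∧
    K.IsQuadrangulation F ∧
    (conv = .forbidden → ∀ e ∈ F, ∀ f ∈ F, ∀ u v, K.Joins e u v → K.Joins f u v → e = f) ∧
    Nonempty (G ≃g K.edgeGraph F)

/-- The identification of antipodal points of the unit sphere `S^n`. -/
def antipodalSetoid (n : ℕ) :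
    Setoid (Metric.sphere (0 : EuclideanSpace ℝ (Fin (n + 1))) 1) where
  r x y := x = y ∨ x = -y
  iseqv :=
    { refl := fun _ => Or.inl rfl
      symm := by
        rintro x y (rfl | rfl)
        · exact Or.inl rfl
        · exact Or.inr (neg_neg y).symm
      trans := by
        rintro x y z (rfl | rfl) (rfl | rfl)
        · exact Or.inl rfl
        · exact Or.inr rfl
        · exact Or.inr rfl
        · exact Or.inl (neg_neg z) }

/-- The real projective space `P^n`, with the quotient topology. -/
abbrev RealProjSpace (n : ℕ) : Type := Quotient (antipodalSetoid n)

namespace GenSimplicialComplex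

variable {m : ℕ} (T : GenSimplicialComplex (EuclideanSpace ℝ (Fin m)))

/-- `T` is an antipodally symmetric triangulation of the unit sphere. -/
def IsSymmetricSphereTriangulation : Prop :=
  T.polyhedron = Metric.sphere 0 1 ∧
  ∀ s : T.Cell, ∃ t : T.Cell, T.closedCell t = -T.closedCell s

/-- `T` is a boundary-symmetric triangulation of the unit ball: the cells contained in the unit
sphere form a symmetric triangulation of the unit sphere. -/
def IsBoundarySymmetricBallTriangulation : Prop :=
  T.polyhedron = Metric.closedBall 0 1 ∧
  (⋃ s : {s : T.Cell // T.closedCell s ⊆ Metric.sphere 0 1}, T.closedCell s.1) =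
    Metric.sphere 0 1 ∧
  ∀ s : T.Cell, T.closedCell s ⊆ Metric.sphere 0 1 →
    ∃ t : T.Cell, T.closedCell t = -T.closedCell s

/-- No simplex contains two antipodal vertices lying on the unit sphere. -/
def NoAntipodalVertices : Prop :=
  ∀ s : T.Cell, ∀ u v : T.vertices, ‖u.1‖ = 1 → v.1 = -u.1 →
    u.1 ∈ T.closedCell s → v.1 ∉ T.closedCell s

/-- Any two antipodal vertices on the unit sphere have different colours. -/
def IsAntisymmetricColouring (c : T.vertices → Bool) : Prop :=
  ∀ u v : T.vertices, ‖u.1‖ = 1 → v.1 = -u.1 → c u ≠ c v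

/-- The simple graph `G` is obtained from the graph formed by the edge set `F` on the vertices
of `T` by identifying all pairs of antipodal vertices on the unit sphere (and, with them, all
pairs of antipodal edges on the unit sphere). The map `π` sends a vertex of `T` to the vertex of
`G` that it becomes. If parallel edges are forbidden, then two elements of `F` may have the same
ends after the identification only if they coincide or are antipodal edges on the sphere. -/
def ObtainedByAntipodalIdentification (conv : ParallelEdges) (F : Set T.Edge)
    {V : Type*} (G : SimpleGraph V) : Prop :=
  ∃ π : T.vertices → V,
    Function.Surjective π ∧
    (∀ u v : T.vertices,
      π u = π v ↔ u = v ∨ (‖u.1‖ = 1 ∧ v.1 = -u.1)) ∧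
    (∀ a b : V, G.Adj a b ↔ ∃ e ∈ F, ∃ u v, T.Joins e u v ∧ π u = a ∧ π v = b) ∧
    (conv = .forbidden → ∀ e ∈ F, ∀ f ∈ F, ∀ u v u' v', T.Joins e u v → T.Joins f u' v' →
      π u = π u' → π v = π v' →
      e = f ∨ (T.closedCell e.1 ⊆ Metric.sphere 0 1 ∧ T.closedCell f.1 = -T.closedCell e.1))

end GenSimplicialComplex

/-- `G` arises from a symmetric triangulation of `S^n`, no simplex of which contains antipodal
vertices, and from a proper antisymmetric `2`-colouring of it. -/
def ArisesFromSphere (conv : ParallelEdges) {V : Type*} (G : SimpleGraph V) (n : ℕ) : Prop :=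
  ∃ T : GenSimplicialComplex (EuclideanSpace ℝ (Fin (n + 1))),
    T.IsSymmetricSphereTriangulation ∧
    T.NoAntipodalVertices ∧
    ∃ c : T.vertices → Bool,
      T.IsProperColouring c ∧
      T.IsAntisymmetricColouring c ∧
      T.ObtainedByAntipodalIdentification conv (T.bichromaticEdges c) G

/-- `G` arises from a boundary-symmetric triangulation of `B^n`, no simplex of which contains
antipodal boundary vertices, and from a proper boundary-antisymmetric `2`-colouring of it. -/
def ArisesFromBall (conv : ParallelEdges) {V : Type*} (G : SimpleGraph V) (n : ℕ) : Prop :=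
  ∃ T : GenSimplicialComplex (EuclideanSpace ℝ (Fin n)),
    T.IsBoundarySymmetricBallTriangulation ∧
    T.NoAntipodalVertices ∧
    ∃ c : T.vertices → Bool,
      T.IsProperColouring c ∧
      T.IsAntisymmetricColouring c ∧
      T.ObtainedByAntipodalIdentification conv (T.bichromaticEdges c) G

/-! The equivalence of (a) and (b) is covering space theory for the projection of `S^n` onto `P^n`.

Downwards, the Veronese map `x ↦ (x i * x j)` identifies exactly the antipodal points of the sphere,
so it realises `P^n` in a Euclidean space, and the images of the cells of `T` triangulate it. Each
cell stays embedded because it contains no two antipodal points (`neg_notMem_closedCell`). A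
bipartition of `G` would pull back to an antipodally invariant colouring `d` of `T`. In each maximal
cell the edges bichromatic for the proper colouring `c` form a connected graph on all vertices, and
they are bichromatic for `d`, so `c` and `d` agree there up to a swap. By connectedness of the
sphere the swap is global, which contradicts the antisymmetry of `c` (`not_isBipartite`). The case
`n = 0` cannot occur on either side.

Upwards, a triangulation of `P^n` lifts to the sphere because simplices are contractible, each cell
having two antipodal lifts (`liftComplex`). For the colouring, note that a quadrangulation 2-colours
the vertices of each cell, uniquely up to a swap. These local colourings form a double cover of the
polyhedron (`colouringBundle`), and what is needed is a section of its pullback to `S^n`. It exists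
over the closed upper hemisphere, which is contractible. Over the equator this section and its
antipodal copy differ by a locally constant swap that is invariant under the antipodal map, hence
constant, so the two glue (`exists_isColouringSystem`). This argument does not use that the sphere
is simply connected and so covers `n = 1` as well. The section and its composition with the
antipodal map differ by one global swap. If that swap is trivial, the colouring descends to `P^n`
and the graph is bipartite; otherwise the colouring is antisymmetric.

For (c) implies (b), two copies of the triangulated ball are placed on the two hemispheres by
vertical projection, the lower one turned by the antipodal map and with colours exchanged (`double`,
`doubleColouring`). Boundary symmetry and antisymmetry make the copies match on the equator. -/

open Set Filter Topology

/-! ### Open and closed faces of the standard simplex -/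

section StdSimplex

variable {d : ℕ}

theorem isClosed_setOf_forall_notMem_eq_zero (S : Finset (Fin (d + 1))) :
    IsClosed {x : stdSimplex ℝ (Fin (d + 1)) | ∀ i ∉ S, x.1 i = 0} := by
  simp only [ofPred_forall]
  refine isClosed_iInter fun i => isClosed_iInter fun _ => isClosed_eq ?_ continuous_const
  exact (continuous_apply i).comp continuous_subtype_val

/-- A point of the closed face becomes a point of the open face when it is moved slightly towards
the barycentre of the face. -/
theorem closure_simplexOpenFace {S : Finset (Fin (d + 1))} (hS : S.Nonempty) :
    closure (simplexOpenFace S) = {x | ∀ i ∉ S, x.1 i = 0} := by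
  classical
  refine subset_antisymm (closure_minimal (fun x hx i hi => ?_)
    (isClosed_setOf_forall_notMem_eq_zero S)) fun x hx => ?_
  · exact le_antisymm (not_lt.1 fun h => hi ((hx i).1 h)) (x.2.1 i)
  · have hc : (0 : ℝ) < S.card := by exact_mod_cast hS.card_pos
    -- The barycentre of the face spanned by `S`.
    let b : Fin (d + 1) → ℝ := fun i => if i ∈ S then (S.card : ℝ)⁻¹ else 0
    have hb : b ∈ stdSimplex ℝ (Fin (d + 1)) := by
      refine ⟨fun i => ?_, ?_⟩
      · dsimp only [b]; split_ifs <;> positivity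
      · simp [b, Finset.sum_ite_mem, hc.ne']
    rw [closure_subtype]
    have ht : Tendsto (fun t : ℝ => (1 - t) • x.1 + t • b) (𝓝[>] 0) (𝓝 x.1) := by
      have : Continuous fun t : ℝ => (1 - t) • x.1 + t • b := by fun_prop
      have h0 := this.tendsto 0
      rw [sub_zero, one_smul, zero_smul, add_zero] at h0
      exact h0.mono_left nhdsWithin_le_nhds
    refine mem_closure_of_tendsto ht ?_
    filter_upwards [Ioo_mem_nhdsGT (zero_lt_one' ℝ)] with t ht
    refine ⟨⟨_, convex_stdSimplex ℝ _ x.2 hb (sub_nonneg.2 ht.2.le) ht.1.le (by ring)⟩, ?_, rfl⟩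
    intro i
    by_cases hi : i ∈ S
    · have h1 : 0 ≤ (1 - t) * x.1 i := mul_nonneg (sub_nonneg.2 ht.2.le) (x.2.1 i)
      have h2 : 0 < t * (S.card : ℝ)⁻¹ := mul_pos ht.1 (inv_pos.2 hc)
      simp only [hi, iff_true, b, Pi.add_apply, Pi.smul_apply, smul_eq_mul, if_true]
      linarith
    · simp [hi, hx i hi, b]

theorem vertex_apply_eq_zero {S : Finset (Fin (d + 1))} {i j : Fin (d + 1)} (hi : i ∈ S)
    (hj : j ∉ S) : (stdSimplex.vertex i : stdSimplex ℝ (Fin (d + 1))).1 j = 0 :=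
  Pi.single_eq_of_ne (by rintro rfl; exact hj hi) _

theorem simplexOpenFace_nonempty {S : Finset (Fin (d + 1))} (hS : S.Nonempty) :
    (simplexOpenFace S).Nonempty := by
  classical
  rw [← closure_nonempty_iff, closure_simplexOpenFace hS]
  obtain ⟨i, hi⟩ := hS
  exact ⟨stdSimplex.vertex i, fun j hj => vertex_apply_eq_zero hi hj⟩

theorem closure_simplexOpenFace_univ :
    closure (simplexOpenFace (Finset.univ : Finset (Fin (d + 1)))) = univ := by
  rw [closure_simplexOpenFace Finset.univ_nonempty]
  simp

theorem exists_mem_simplexOpenFace (x : stdSimplex ℝ (Fin (d + 1))) :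
    ∃ S : Finset (Fin (d + 1)), S.Nonempty ∧ x ∈ simplexOpenFace S := by
  classical
  refine ⟨Finset.univ.filter fun i => 0 < x.1 i, ?_, fun i => by simp⟩
  by_contra h
  rw [Finset.not_nonempty_iff_eq_empty, Finset.filter_eq_empty_iff] at h
  have : ∑ i, x.1 i = 0 := Finset.sum_eq_zero fun i hi => le_antisymm (not_lt.1 (h hi)) (x.2.1 i)
  rw [x.2.2] at this
  exact one_ne_zero this

end StdSimplex

/-! ### Faces, vertices and edges of a generalised simplicial complex -/

namespace GenSimplicialComplex

variable {X : Type*} [TopologicalSpace X] (K : GenSimplicialComplex X)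

/-- The open simplex (interior) of the cell `s`. -/
def openCell (s : K.Cell) : Set X := K.char s '' simplexOpenFace Finset.univ

variable {K}

theorem openCell_subset_closedCell (s : K.Cell) : K.openCell s ⊆ K.closedCell s :=
  image_subset_range _ _

theorem closedCell_subset_polyhedron (s : K.Cell) : K.closedCell s ⊆ K.polyhedron :=
  subset_iUnion _ s

theorem mem_polyhedron {x : X} : x ∈ K.polyhedron ↔ ∃ s, x ∈ K.closedCell s := mem_iUnion

theorem openCell_nonempty (s : K.Cell) : (K.openCell s).Nonempty :=
  (simplexOpenFace_nonempty Finset.univ_nonempty).image _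

theorem eq_of_mem_openCell {s t : K.Cell} {x : X} (hs : x ∈ K.openCell s)
    (ht : x ∈ K.openCell t) : s = t := by
  by_contra h
  exact disjoint_left.1 (K.disjoint_openCell s t h) hs ht

theorem exists_openCell_of_mem_closedCell {s : K.Cell} {x : X} (hx : x ∈ K.closedCell s) :
    ∃ t, x ∈ K.openCell t := by
  obtain ⟨y, rfl⟩ := hx
  obtain ⟨S, hS, hy⟩ := exists_mem_simplexOpenFace y
  obtain ⟨t, -, ht⟩ := K.exists_face s S hS
  exact ⟨t, (ht.symm ▸ mem_image_of_mem _ hy : _ ∈ K.char t '' _)⟩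

theorem isCompact_closedCell (s : K.Cell) : IsCompact (K.closedCell s) :=
  isCompact_range (K.continuous_char s)

theorem eq_of_mem_closedCell_of_dim_eq_zero {s : K.Cell} (hs : K.dim s = 0) {a b : X}
    (ha : a ∈ K.closedCell s) (hb : b ∈ K.closedCell s) : a = b := by
  obtain ⟨x, rfl⟩ := ha
  obtain ⟨y, rfl⟩ := hb
  have : Subsingleton (Fin (K.dim s + 1)) := by rw [hs, zero_add]; infer_instance
  rw [Subsingleton.elim x y]

/-- A cell of positive dimension has two distinct vertices. The criterion mentions only closed cells
as point sets, so it is visibly preserved by the antipodal map. -/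
theorem mem_vertices_iff {x : X} : x ∈ K.vertices ↔ ∃ s, K.closedCell s = {x} := by
  constructor
  · rintro ⟨s, hs, hx⟩
    exact ⟨s, subset_antisymm (fun y hy => eq_of_mem_closedCell_of_dim_eq_zero hs hy hx)
      (singleton_subset_iff.2 hx)⟩
  · rintro ⟨s, hs⟩
    refine ⟨s, ?_, hs.symm ▸ rfl⟩
    by_contra hd
    obtain ⟨k, hk⟩ := Nat.exists_eq_succ_of_ne_zero hd
    have : (stdSimplex.vertex 0 : stdSimplex ℝ (Fin (K.dim s + 1))) = stdSimplex.vertex 1 := by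
      apply K.injective_char s
      have h0 : K.char s (stdSimplex.vertex 0) ∈ K.closedCell s := mem_range_self _
      have h1 : K.char s (stdSimplex.vertex 1) ∈ K.closedCell s := mem_range_self _
      rw [hs, mem_singleton_iff] at h0 h1
      rw [h0, h1]
    have := stdSimplex.vertex_injective this
    rw [Fin.ext_iff, Fin.val_zero, Fin.val_one'] at this
    rw [hk, Nat.mod_eq_of_lt (by omega)] at this
    omega

theorem char_vertex_mem_vertices (s : K.Cell) (i : Fin (K.dim s + 1)) :
    K.char s (stdSimplex.vertex i) ∈ K.vertices := by
  obtain ⟨t, hd, ht⟩ := K.exists_face s {i} (Finset.singleton_nonempty i)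
  rw [Finset.card_singleton] at hd
  refine ⟨t, by omega, openCell_subset_closedCell t ?_⟩
  rw [openCell, ht]
  refine mem_image_of_mem _ fun j => ?_
  rcases eq_or_ne j i with rfl | hj <;> simp [*]

theorem Joins.symm {u v : K.vertices} {e : K.Edge} (h : K.Joins e u v) : K.Joins e v u :=
  ⟨h.1.symm, h.2.2, h.2.1⟩

theorem exists_vertex_mem (s : K.Cell) : ∃ v : K.vertices, (v : X) ∈ K.closedCell s :=
  ⟨⟨_, char_vertex_mem_vertices s 0⟩, mem_range_self _⟩

variable [T2Space X]

theorem isClosed_closedCell (s : K.Cell) : IsClosed (K.closedCell s) :=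
  (isCompact_closedCell s).isClosed

theorem closure_char_image (s : K.Cell) (A : Set (stdSimplex ℝ (Fin (K.dim s + 1)))) :
    closure (K.char s '' A) = K.char s '' closure A :=
  ((K.continuous_char s).isClosedMap.closure_image_eq_of_continuous (K.continuous_char s) A)

theorem closure_openCell (s : K.Cell) : closure (K.openCell s) = K.closedCell s := by
  rw [openCell, closure_char_image, closure_simplexOpenFace_univ, image_univ, closedCell]

/-- A cell whose open simplex meets the closed cell `s` is a face of `s`. -/
theorem exists_face_of_mem {s t : K.Cell} {x : X} (hs : x ∈ K.closedCell s)
    (ht : x ∈ K.openCell t) : ∃ S : Finset (Fin (K.dim s + 1)), S.Nonempty ∧ K.dim t + 1 = S.card ∧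
      K.openCell t = K.char s '' simplexOpenFace S ∧
      K.closedCell t = K.char s '' {y | ∀ i ∉ S, y.1 i = 0} := by
  obtain ⟨y, rfl⟩ := hs
  obtain ⟨S, hS, hy⟩ := exists_mem_simplexOpenFace y
  obtain ⟨t', hd, ht'⟩ := K.exists_face s S hS
  have hyt : K.char s y ∈ K.openCell t' := by
    rw [openCell, ht']
    exact mem_image_of_mem _ hy
  obtain rfl := eq_of_mem_openCell ht hyt
  refine ⟨S, hS, hd, ht', ?_⟩
  rw [← closure_openCell, openCell, ht', closure_char_image, closure_simplexOpenFace hS]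

/-- The cell whose open simplex contains `x` is therefore the smallest closed cell containing `x`.
Most later arguments about faces reduce to this. -/
theorem closedCell_subset_of_mem {s t : K.Cell} {x : X} (hs : x ∈ K.closedCell s)
    (ht : x ∈ K.openCell t) : K.closedCell t ⊆ K.closedCell s := by
  obtain ⟨S, -, -, -, h⟩ := exists_face_of_mem hs ht
  rw [h]
  exact image_subset_range _ _

theorem exists_face_of_subset {s t : K.Cell} (h : K.closedCell t ⊆ K.closedCell s) :
    ∃ S : Finset (Fin (K.dim s + 1)), S.Nonempty ∧ K.dim t + 1 = S.card ∧
      K.openCell t = K.char s '' simplexOpenFace S ∧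
      K.closedCell t = K.char s '' {y | ∀ i ∉ S, y.1 i = 0} := by
  obtain ⟨x, hx⟩ := openCell_nonempty t
  exact exists_face_of_mem (h (openCell_subset_closedCell t hx)) hx

/-- Each of the two cells is a face of the other, so the dimensions agree and the face is the whole
cell. Cells may thus be compared as point sets. -/
theorem closedCell_injective : Function.Injective K.closedCell := by
  intro s t h
  obtain ⟨S, -, hd, h1, h2⟩ := exists_face_of_subset h.le
  obtain ⟨S', -, hd', -⟩ := exists_face_of_subset h.ge
  have hS : S = Finset.univ := by
    rw [← Finset.card_eq_iff_eq_univ, Fintype.card_fin]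
    have := S.card_le_univ
    have := S'.card_le_univ
    simp only [Fintype.card_fin] at *
    omega
  subst hS
  obtain ⟨x, hx⟩ := openCell_nonempty s
  exact eq_of_mem_openCell hx (by rw [h1] at hx; exact hx)

theorem exists_char_vertex_eq {s : K.Cell} {x : X} (hx : x ∈ K.vertices)
    (hs : x ∈ K.closedCell s) : ∃ i, K.char s (stdSimplex.vertex i) = x := by
  obtain ⟨p, hp⟩ := mem_vertices_iff.1 hx
  obtain ⟨y, hy⟩ := openCell_nonempty p
  obtain rfl : y = x := by
    have := openCell_subset_closedCell p hy
    rwa [hp] at this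
  obtain ⟨S, hS, hd, -, h⟩ := exists_face_of_mem hs hy
  obtain ⟨i, hi⟩ := hS
  refine ⟨i, ?_⟩
  have : K.char s (stdSimplex.vertex i) ∈ K.closedCell p := by
    rw [h]
    exact mem_image_of_mem _ fun j hj => vertex_apply_eq_zero hi hj
  rwa [hp] at this

/-- This recovers the dimension from point sets, which shows that antipodal cells have equal
dimension and that an edge has two ends. -/
theorem ncard_vertices_inter (s : K.Cell) :
    (K.vertices ∩ K.closedCell s).ncard = K.dim s + 1 := by
  have : K.vertices ∩ K.closedCell s =
      range fun i : Fin (K.dim s + 1) => K.char s (stdSimplex.vertex i) := by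
    ext x
    refine ⟨fun h => exists_char_vertex_eq h.1 h.2, ?_⟩
    rintro ⟨i, rfl⟩
    exact ⟨char_vertex_mem_vertices s i, mem_range_self _⟩
  have hinj : Function.Injective fun i : Fin (K.dim s + 1) => K.char s (stdSimplex.vertex i) :=
    (K.injective_char s).comp stdSimplex.vertex_injective
  rw [this, ← image_univ, ncard_image_of_injective _ hinj, ncard_univ, Nat.card_fin]

/-- A cell joins any two of its vertices by an edge. -/
theorem exists_edge {s : K.Cell} {u v : K.vertices} (huv : u ≠ v) (hu : (u : X) ∈ K.closedCell s)
    (hv : (v : X) ∈ K.closedCell s) :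
    ∃ e : K.Edge, K.closedCell e.1 ⊆ K.closedCell s ∧ K.Joins e u v := by
  classical
  obtain ⟨i, hi⟩ := exists_char_vertex_eq u.2 hu
  obtain ⟨j, hj⟩ := exists_char_vertex_eq v.2 hv
  have hij : i ≠ j := by
    rintro rfl
    exact huv (Subtype.ext (hi.symm.trans hj))
  obtain ⟨e, hd, he⟩ := K.exists_face s {i, j} (Finset.insert_nonempty _ _)
  rw [Finset.card_pair hij] at hd
  have hc : K.closedCell e = K.char s '' {y | ∀ k ∉ ({i, j} : Finset _), y.1 k = 0} := by
    rw [← closure_openCell, openCell, he, closure_char_image,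
      closure_simplexOpenFace (Finset.insert_nonempty _ _)]
  refine ⟨⟨e, by omega⟩, ?_, huv, ?_, ?_⟩
  · rw [hc]; exact image_subset_range _ _
  · rw [← hi]
    simp only [hc]
    exact mem_image_of_mem _ fun k hk => vertex_apply_eq_zero (by simp) hk
  · rw [← hj]
    simp only [hc]
    exact mem_image_of_mem _ fun k hk => vertex_apply_eq_zero (by simp) hk

/-- The edge is the face of `s` on some index set `S` of size two, and its ends force `i` and `j`
into `S`. -/
theorem Joins.openCell_eq {s : K.Cell} {u v : K.vertices} {e : K.Edge} (h : K.Joins e u v)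
    (he : K.closedCell e.1 ⊆ K.closedCell s) {i j : Fin (K.dim s + 1)}
    (hi : K.char s (stdSimplex.vertex i) = u) (hj : K.char s (stdSimplex.vertex j) = v) :
    K.openCell e.1 = K.char s '' simplexOpenFace {i, j} := by
  classical
  obtain ⟨S, -, hd, ho, hc⟩ := exists_face_of_subset he
  have key : ∀ k, K.char s (stdSimplex.vertex k) ∈ K.closedCell e.1 → k ∈ S := by
    intro k hk
    rw [hc] at hk
    obtain ⟨y, hy, hyk⟩ := hk
    obtain rfl := K.injective_char s hyk
    by_contra hkS
    simpa using hy k hkS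
  have hij : i ≠ j := by
    rintro rfl
    exact h.1 (Subtype.ext (hi.symm.trans hj))
  have hS : {i, j} = S := by
    apply Finset.eq_of_subset_of_card_le
    · intro k hk
      rw [Finset.mem_insert, Finset.mem_singleton] at hk
      rcases hk with rfl | rfl
      · exact key _ (hi ▸ h.2.1)
      · exact key _ (hj ▸ h.2.2)
    · rw [← hd, e.2, Finset.card_pair hij]
  rw [ho, hS]

/-- The edge of a cell joining two given vertices is unique. -/
theorem Joins.eq_of_subset {s : K.Cell} {u v : K.vertices} {e f : K.Edge} (he : K.Joins e u v)
    (hf : K.Joins f u v) (hes : K.closedCell e.1 ⊆ K.closedCell s)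
    (hfs : K.closedCell f.1 ⊆ K.closedCell s) : e = f := by
  obtain ⟨i, hi⟩ := exists_char_vertex_eq u.2 (hes he.2.1)
  obtain ⟨j, hj⟩ := exists_char_vertex_eq v.2 (hes he.2.2)
  have h := (he.openCell_eq hes hi hj).trans (hf.openCell_eq hfs hi hj).symm
  obtain ⟨x, hx⟩ := openCell_nonempty e.1
  exact Subtype.ext (eq_of_mem_openCell hx (h ▸ hx))

/-- An edge has exactly two ends. -/
theorem Joins.eq_or_eq {u v w : K.vertices} {e : K.Edge} (h : K.Joins e u v)
    (hw : (w : X) ∈ K.closedCell e.1) : w = u ∨ w = v := by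
  by_contra! hne
  have hsub : ({(u : X), (v : X), (w : X)} : Set X) ⊆ K.vertices ∩ K.closedCell e.1 := by
    rintro x (rfl | rfl | rfl)
    exacts [⟨u.2, h.2.1⟩, ⟨v.2, h.2.2⟩, ⟨w.2, hw⟩]
  have hfin : (K.vertices ∩ K.closedCell e.1).Finite := by
    apply finite_of_ncard_pos
    rw [ncard_vertices_inter]
    omega
  have h1 := ncard_le_ncard hsub hfin
  rw [ncard_vertices_inter, e.2, ncard_eq_three.2 ⟨_, _, _, fun h' => h.1 (Subtype.ext h'),
    fun h' => hne.1 (Subtype.ext h'.symm), fun h' => hne.2 (Subtype.ext h'.symm), rfl⟩] at h1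
  omega

theorem exists_joins (e : K.Edge) : ∃ u v, K.Joins e u v := by
  have h := ncard_vertices_inter e.1
  rw [e.2] at h
  obtain ⟨x, y, hxy, hs⟩ := ncard_eq_two.1 h
  have hx : x ∈ K.vertices ∩ K.closedCell e.1 := hs ▸ mem_insert _ _
  have hy : y ∈ K.vertices ∩ K.closedCell e.1 := hs ▸ mem_insert_of_mem _ rfl
  exact ⟨⟨x, hx.1⟩, ⟨y, hy.1⟩, fun h => hxy (congrArg Subtype.val h), hx.2, hy.2⟩

theorem exists_isMaximalCell (s : K.Cell) :
    ∃ t, K.IsMaximalCell t ∧ K.closedCell s ⊆ K.closedCell t := by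
  have := K.finite_cell
  obtain ⟨A, hA, hmax⟩ := (finite_range K.closedCell).exists_le_maximal (mem_range_self s)
  obtain ⟨t, rfl⟩ := hmax.prop
  refine ⟨t, fun r hr => ?_, hA⟩
  exact closedCell_injective (subset_antisymm (hmax.le_of_ge (mem_range_self r) hr) hr)

end GenSimplicialComplex

namespace GenSimplicialComplex

/-! ### The antipodal map on cells contained in the unit sphere -/

section Antipodes

variable {m : ℕ} {T : GenSimplicialComplex (EuclideanSpace ℝ (Fin m))}

/-- The unit sphere is the union of a subcomplex, which is closed under the antipodal map. -/
def IsSphereSymmetric (T : GenSimplicialComplex (EuclideanSpace ℝ (Fin m))) : Prop :=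
  (∀ x ∈ Metric.sphere (0 : EuclideanSpace ℝ (Fin m)) 1,
    ∃ s, T.closedCell s ⊆ Metric.sphere 0 1 ∧ x ∈ T.closedCell s) ∧
  ∀ s, T.closedCell s ⊆ Metric.sphere 0 1 → ∃ t, T.closedCell t = -T.closedCell s

theorem IsSymmetricSphereTriangulation.closedCell_subset (h : T.IsSymmetricSphereTriangulation)
    (s : T.Cell) : T.closedCell s ⊆ Metric.sphere 0 1 :=
  h.1 ▸ closedCell_subset_polyhedron s

theorem IsSymmetricSphereTriangulation.isSphereSymmetric (h : T.IsSymmetricSphereTriangulation) :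
    T.IsSphereSymmetric := by
  refine ⟨fun x hx => ?_, fun s _ => h.2 s⟩
  rw [← h.1, mem_polyhedron] at hx
  obtain ⟨s, hs⟩ := hx
  exact ⟨s, h.closedCell_subset s, hs⟩

theorem IsBoundarySymmetricBallTriangulation.isSphereSymmetric
    (h : T.IsBoundarySymmetricBallTriangulation) : T.IsSphereSymmetric := by
  refine ⟨fun x hx => ?_, h.2.2⟩
  rw [← h.2.1, mem_iUnion] at hx
  obtain ⟨⟨s, hs⟩, hx⟩ := hx
  exact ⟨s, hs, hx⟩

theorem neg_subset_sphere {A : Set (EuclideanSpace ℝ (Fin m))} (h : A ⊆ Metric.sphere 0 1) :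
    -A ⊆ Metric.sphere 0 1 := fun x hx => by
  have := h (Set.mem_neg.1 hx)
  simpa using this

namespace IsSphereSymmetric

variable (h : T.IsSphereSymmetric)
include h

theorem closedCell_subset_sphere {t : T.Cell} {x : EuclideanSpace ℝ (Fin m)} (hx : ‖x‖ = 1)
    (ht : x ∈ T.openCell t) : T.closedCell t ⊆ Metric.sphere 0 1 := by
  obtain ⟨s, hs, hxs⟩ := h.1 x (by simpa using hx)
  exact (closedCell_subset_of_mem hxs ht).trans hs

/-- Let `r` be the smallest cell containing `-x`; it is a face of `t`. The antipode of `r` contains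
`x`, hence contains `s`, so `r` contains `t` and equals it. -/
theorem neg_mem_openCell {s t : T.Cell} (hs : T.closedCell s ⊆ Metric.sphere 0 1)
    (hst : T.closedCell t = -T.closedCell s) {x : EuclideanSpace ℝ (Fin m)}
    (hx : x ∈ T.openCell s) : -x ∈ T.openCell t := by
  have hxt : -x ∈ T.closedCell t := by
    rw [hst, Set.neg_mem_neg]
    exact openCell_subset_closedCell s hx
  obtain ⟨r, hr⟩ := exists_openCell_of_mem_closedCell hxt
  have hrt := closedCell_subset_of_mem hxt hr
  obtain ⟨r', hr'⟩ := h.2 r (hrt.trans (hst ▸ neg_subset_sphere hs))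
  have hxr : x ∈ T.closedCell r' := by
    rw [hr', Set.mem_neg]
    exact openCell_subset_closedCell r hr
  have hsr := closedCell_subset_of_mem hxr hx
  have : r = t := by
    refine closedCell_injective (subset_antisymm hrt ?_)
    rw [hst, Set.neg_subset, ← hr']
    exact hsr
  exact this ▸ hr

theorem openCell_eq_neg {s t : T.Cell} (hs : T.closedCell s ⊆ Metric.sphere 0 1)
    (hst : T.closedCell t = -T.closedCell s) : T.openCell t = -T.openCell s := by
  refine subset_antisymm (fun x hx => ?_) fun x hx => ?_
  · exact h.neg_mem_openCell (hst ▸ neg_subset_sphere hs) (by rw [hst, neg_neg]) hx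
  · simpa using h.neg_mem_openCell hs hst hx

theorem neg_mem_vertices {x : EuclideanSpace ℝ (Fin m)} (hx : ‖x‖ = 1) (hv : x ∈ T.vertices) :
    -x ∈ T.vertices := by
  obtain ⟨p, hp⟩ := mem_vertices_iff.1 hv
  obtain ⟨q, hq⟩ := h.2 p (by rw [hp]; simpa using hx)
  exact mem_vertices_iff.2 ⟨q, by rw [hq, hp, Set.neg_singleton]⟩

theorem dim_eq {s t : T.Cell} (hs : T.closedCell s ⊆ Metric.sphere 0 1)
    (hst : T.closedCell t = -T.closedCell s) : T.dim t = T.dim s := by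
  have : T.vertices ∩ T.closedCell t = Neg.neg '' (T.vertices ∩ T.closedCell s) := by
    rw [Set.image_neg_eq_neg, hst]
    ext x
    simp only [mem_inter_iff, Set.mem_neg]
    refine and_congr_left fun hx => ?_
    have hn : ‖-x‖ = 1 := by simpa using hs hx
    exact ⟨h.neg_mem_vertices (by simpa using hn),
      fun hv => by simpa using h.neg_mem_vertices hn hv⟩
  have hc := ncard_vertices_inter t
  rw [this, ncard_image_of_injective _ neg_injective, ncard_vertices_inter] at hc
  omega

/-- If `x` and `-x` both lay in `s`, then so would the smallest cell containing `x` and its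
antipode, and with them a pair of antipodal vertices. This upgrade from vertices to points makes the
quotient map injective on cells. -/
theorem neg_notMem_closedCell (hN : T.NoAntipodalVertices) {s : T.Cell}
    {x : EuclideanSpace ℝ (Fin m)} (hn : ‖x‖ = 1) (hx : x ∈ T.closedCell s) :
    -x ∉ T.closedCell s := by
  intro hnx
  obtain ⟨t, ht⟩ := exists_openCell_of_mem_closedCell hx
  have hts := h.closedCell_subset_sphere hn ht
  obtain ⟨t', ht'⟩ := h.2 t hts
  obtain ⟨v, hv⟩ := exists_vertex_mem t
  have hvn : ‖(v : EuclideanSpace ℝ (Fin m))‖ = 1 := by simpa using hts hv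
  refine hN s v ⟨-v, h.neg_mem_vertices hvn v.2⟩ hvn rfl (closedCell_subset_of_mem hx ht hv) ?_
  refine closedCell_subset_of_mem hnx (h.neg_mem_openCell hts ht' ht) ?_
  rw [ht', Set.neg_mem_neg]
  exact hv

end IsSphereSymmetric

end Antipodes

/-! ### Vertex colourings and connectedness -/

section Connected

variable {X : Type*} [TopologicalSpace X] [T2Space X] {K : GenSimplicialComplex X}

/-- Otherwise the cells having a vertex of one colour and those having a vertex of the other give
two closed sets covering the polyhedron. They meet, and a vertex of the smallest cell at a common
point would have both colours. -/
theorem apply_eq_of_isPreconnected (hK : IsPreconnected K.polyhedron) (c : K.vertices → Bool)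
    (hc : ∀ s, ∀ u v : K.vertices, (u : X) ∈ K.closedCell s → (v : X) ∈ K.closedCell s → c u = c v)
    (u v : K.vertices) : c u = c v := by
  have := K.finite_cell
  by_contra hne
  let A : Bool → Set X := fun b => ⋃ s : {s // ∃ w : K.vertices, (w : X) ∈ K.closedCell s ∧ c w = b},
    K.closedCell s.1
  have hA : ∀ b, IsClosed (A b) := fun b =>
    isClosed_iUnion_of_finite fun s => isClosed_closedCell _
  have hmem : ∀ w : K.vertices, (w : X) ∈ A (c w) := by
    intro w
    obtain ⟨p, hp⟩ := mem_vertices_iff.1 w.2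
    have hw : (w : X) ∈ K.closedCell p := hp ▸ mem_singleton _
    exact mem_iUnion.2 ⟨⟨p, w, hw, rfl⟩, hw⟩
  have hpoly : ∀ w : K.vertices, (w : X) ∈ K.polyhedron := by
    intro w
    obtain ⟨p, hp⟩ := mem_vertices_iff.1 w.2
    exact closedCell_subset_polyhedron p (hp ▸ mem_singleton _)
  obtain ⟨x, -, hx, hx'⟩ := isPreconnected_closed_iff.1 hK (A (c u)) (A (c v)) (hA _) (hA _)
    (fun x hx => by
      obtain ⟨s, hs⟩ := mem_polyhedron.1 hx
      obtain ⟨w, hw⟩ := exists_vertex_mem s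
      have : x ∈ A (c w) := mem_iUnion.2 ⟨⟨s, w, hw, rfl⟩, hs⟩
      by_cases hwu : c w = c u
      · exact Or.inl (hwu ▸ this)
      · have : c w = c v := by
          revert hne hwu
          cases c w <;> cases c u <;> cases c v <;> simp
        exact Or.inr (this ▸ ‹x ∈ A (c w)›))
    ⟨u, hpoly u, hmem u⟩ ⟨v, hpoly v, hmem v⟩
  obtain ⟨⟨s, w, hw, hwu⟩, hs⟩ := mem_iUnion.1 hx
  obtain ⟨⟨t, z, hz, hzv⟩, ht⟩ := mem_iUnion.1 hx'
  obtain ⟨r, hr⟩ := exists_openCell_of_mem_closedCell hs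
  obtain ⟨y, hy⟩ := exists_vertex_mem r
  exact hne ((hwu.symm.trans (hc s w y hw (closedCell_subset_of_mem hs hr hy))).trans
    ((hc t y z (closedCell_subset_of_mem ht hr hy) hz).trans hzv))

theorem Joins.mem_bichromaticEdges_iff {c : K.vertices → Bool} {e : K.Edge} {u v : K.vertices}
    (h : K.Joins e u v) : e ∈ K.bichromaticEdges c ↔ c u ≠ c v := by
  refine ⟨?_, fun hc => ⟨u, v, h, hc⟩⟩
  rintro ⟨u', v', h', hc⟩
  rcases h.eq_or_eq h'.2.1 with rfl | rfl <;> rcases h.eq_or_eq h'.2.2 with rfl | rfl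
  exacts [absurd rfl hc, hc, hc.symm, absurd rfl hc]

end Connected

end GenSimplicialComplex

/-! ### The Veronese embedding -/

/-- The Veronese map `x ↦ (x i * x j)`, which embeds the projective space into a Euclidean
space. -/
def veronese {k : ℕ} (x : EuclideanSpace ℝ (Fin k)) : EuclideanSpace ℝ (Fin (k * k)) :=
  WithLp.toLp 2 fun p => x (finProdFinEquiv.symm p).1 * x (finProdFinEquiv.symm p).2

theorem continuous_veronese {k : ℕ} : Continuous (veronese (k := k)) := by
  unfold veronese
  fun_prop

/-- A nonzero coordinate `x i` is determined up to sign by its square, and its products with the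
other coordinates then determine those with the same sign. -/
theorem veronese_eq_iff {k : ℕ} {x y : EuclideanSpace ℝ (Fin k)} :
    veronese x = veronese y ↔ x = y ∨ x = -y := by
  constructor
  · intro h
    have hp : ∀ i j, x i * x j = y i * y j := by
      intro i j
      have := congrArg (fun z : EuclideanSpace ℝ (Fin (k * k)) => z (finProdFinEquiv (i, j))) h
      simpa only [veronese, Equiv.symm_apply_apply] using this
    by_cases hx : ∀ i, x i = 0
    · left
      ext i
      have := hp i i
      rw [hx i, zero_mul] at this
      rw [hx i, mul_self_eq_zero.1 this.symm]
    · push Not at hx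
      obtain ⟨i, hi⟩ := hx
      rcases mul_self_eq_mul_self_iff.1 (hp i i) with hxy | hxy
      · left
        ext j
        have := hp i j
        rw [← hxy] at this
        exact mul_left_cancel₀ hi this
      · right
        ext j
        have := hp i j
        rw [← neg_eq_iff_eq_neg.2 hxy] at this
        refine mul_left_cancel₀ hi ?_
        rw [this, PiLp.neg_apply]
        ring
  · rintro (rfl | rfl)
    · rfl
    · ext p
      simp [veronese]

theorem veronese_neg {k : ℕ} (x : EuclideanSpace ℝ (Fin k)) : veronese (-x) = veronese x :=
  veronese_eq_iff.2 (Or.inr rfl)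

theorem eq_or_eq_neg_iff_veronese {k : ℕ} {x y : EuclideanSpace ℝ (Fin k)} :
    (x = y ∨ y = -x) ↔ veronese x = veronese y := by
  rw [veronese_eq_iff, eq_comm (a := y) (b := -x), neg_eq_iff_eq_neg]

/-! ### The quotient of a symmetric triangulation of the sphere -/

namespace GenSimplicialComplex

variable {k : ℕ} (T : GenSimplicialComplex (EuclideanSpace ℝ (Fin k)))

/-- Two cells are equivalent if they are equal or antipodal. -/
def antipodalCellSetoid : Setoid T.Cell where
  r s t := T.closedCell s = T.closedCell t ∨ T.closedCell s = -T.closedCell t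
  iseqv :=
    { refl := fun _ => Or.inl rfl
      symm := by
        rintro s t (h | h)
        · exact Or.inl h.symm
        · exact Or.inr (by rw [h, neg_neg])
      trans := by
        rintro r s t (h | h) (h' | h')
        · exact Or.inl (h.trans h')
        · exact Or.inr (h.trans h')
        · exact Or.inr (by rw [h, h'])
        · exact Or.inl (by rw [h, h', neg_neg]) }

variable {T}

namespace IsSymmetricSphereTriangulation

theorem norm_eq_one (hT : T.IsSymmetricSphereTriangulation) {s : T.Cell}
    {x : EuclideanSpace ℝ (Fin k)} (hx : x ∈ T.closedCell s) : ‖x‖ = 1 := by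
  simpa using hT.closedCell_subset s hx

theorem norm_vertex (hT : T.IsSymmetricSphereTriangulation) (x : T.vertices) : ‖x.1‖ = 1 := by
  obtain ⟨p, hp⟩ := mem_vertices_iff.1 x.2
  exact hT.norm_eq_one (s := p) (hp ▸ mem_singleton _)

theorem veronese_injOn (hT : T.IsSymmetricSphereTriangulation) (hN : T.NoAntipodalVertices)
    (s : T.Cell) : InjOn veronese (T.closedCell s) := by
  intro x hx y hy hxy
  rcases veronese_eq_iff.1 hxy with h | rfl
  · exact h
  · exact absurd hx (hT.isSphereSymmetric.neg_notMem_closedCell hN (hT.norm_eq_one hy) hy)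

/-- A quotient cell is parametrised through a chosen representative; this says that dimension and
image do not depend on the choice. -/
theorem out_spec (hT : T.IsSymmetricSphereTriangulation) (s : T.Cell) :
    T.dim (Quotient.mk T.antipodalCellSetoid s).out = T.dim s ∧
    veronese '' T.openCell (Quotient.mk T.antipodalCellSetoid s).out =
      veronese '' T.openCell s ∧
    veronese '' T.closedCell (Quotient.mk T.antipodalCellSetoid s).out =
      veronese '' T.closedCell s := by
  have himg : ∀ A : Set (EuclideanSpace ℝ (Fin k)), veronese '' (-A) = veronese '' A := by
    intro A
    rw [← Set.image_neg_eq_neg, image_image]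
    simp only [veronese_neg]
  rcases Quotient.mk_out (s := T.antipodalCellSetoid) s with h | h
  · rw [closedCell_injective h]
    exact ⟨rfl, rfl, rfl⟩
  · have hs := hT.closedCell_subset s
    rw [hT.isSphereSymmetric.dim_eq hs h, hT.isSphereSymmetric.openCell_eq_neg hs h, h, himg, himg]
    exact ⟨rfl, rfl, rfl⟩

/-- The triangulation of the projective space obtained by identifying antipodal points in a
symmetric triangulation of the sphere. -/
noncomputable def projComplex (hT : T.IsSymmetricSphereTriangulation)
    (hN : T.NoAntipodalVertices) :
    GenSimplicialComplex (EuclideanSpace ℝ (Fin (k * k))) where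
  Cell := Quotient T.antipodalCellSetoid
  finite_cell := by
    have := T.finite_cell
    infer_instance
  dim c := T.dim c.out
  char c := veronese ∘ T.char c.out
  continuous_char c := continuous_veronese.comp (T.continuous_char _)
  injective_char c := by
    intro x y h
    exact T.injective_char _ (hT.veronese_injOn hN _ (mem_range_self x) (mem_range_self y) h)
  exists_face c S hS := by
    obtain ⟨t, hd, ht⟩ := T.exists_face c.out S hS
    obtain ⟨h1, h2, -⟩ := hT.out_spec t
    refine ⟨Quotient.mk _ t, by rw [h1, hd], ?_⟩
    rw [image_comp, image_comp, ← ht]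
    exact h2
  disjoint_openCell c c' hcc := by
    rw [image_comp, image_comp, disjoint_left]
    rintro _ ⟨x, hx, rfl⟩ ⟨y, hy, hxy⟩
    refine hcc ?_
    rw [← Quotient.out_eq c, ← Quotient.out_eq c']
    refine Quotient.sound ?_
    change x ∈ T.openCell _ at hx
    change y ∈ T.openCell _ at hy
    rcases veronese_eq_iff.1 hxy with rfl | rfl
    · exact Or.inl (congrArg _ (eq_of_mem_openCell hx hy))
    · obtain ⟨t, ht⟩ := hT.2 c.out
      have := hT.isSphereSymmetric.neg_mem_openCell (hT.closedCell_subset _) ht hx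
      rw [eq_of_mem_openCell this hy] at ht
      exact Or.inr (by rw [ht, neg_neg])

section projComplex

variable (hT : T.IsSymmetricSphereTriangulation) (hN : T.NoAntipodalVertices)

/-- The cell of the quotient complex represented by a cell of the sphere. -/
def projCell (s : T.Cell) : (hT.projComplex hN).Cell := Quotient.mk _ s

theorem projCell_surjective : Function.Surjective (hT.projCell hN) := Quotient.mk_surjective

theorem closedCell_projCell (s : T.Cell) :
    (hT.projComplex hN).closedCell (hT.projCell hN s) = veronese '' T.closedCell s := by
  rw [← (hT.out_spec s).2.2]
  exact range_comp veronese (T.char _)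

theorem dim_projCell (s : T.Cell) : (hT.projComplex hN).dim (hT.projCell hN s) = T.dim s :=
  (hT.out_spec s).1

theorem projCell_eq_iff {s t : T.Cell} : hT.projCell hN s = hT.projCell hN t ↔
    T.closedCell s = T.closedCell t ∨ T.closedCell s = -T.closedCell t :=
  Quotient.eq (r := T.antipodalCellSetoid)

theorem veronese_mem_iff {s : T.Cell} {x : EuclideanSpace ℝ (Fin k)} :
    veronese x ∈ (hT.projComplex hN).closedCell (hT.projCell hN s) ↔
      x ∈ T.closedCell s ∨ -x ∈ T.closedCell s := by
  rw [closedCell_projCell]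
  constructor
  · rintro ⟨y, hy, hxy⟩
    rcases veronese_eq_iff.1 hxy with rfl | rfl
    exacts [Or.inl hy, Or.inr hy]
  · rintro (h | h)
    exacts [⟨x, h, rfl⟩, ⟨-x, h, veronese_neg x⟩]

/-- It suffices to follow one interior point `x` of `s`: either `x` or `-x` lies in `t`, and the
whole of `s` or of its antipode follows. -/
theorem projCell_subset_iff {s t : T.Cell} :
    (hT.projComplex hN).closedCell (hT.projCell hN s) ⊆
      (hT.projComplex hN).closedCell (hT.projCell hN t) ↔
    T.closedCell s ⊆ T.closedCell t ∨ T.closedCell s ⊆ -T.closedCell t := by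
  constructor
  · intro h
    obtain ⟨x, hx⟩ := openCell_nonempty s
    have hxs := openCell_subset_closedCell s hx
    rcases (hT.veronese_mem_iff hN).1 (h ((hT.veronese_mem_iff hN).2 (Or.inl hxs))) with h' | h'
    · exact Or.inl (closedCell_subset_of_mem h' hx)
    · obtain ⟨s', hs'⟩ := hT.2 s
      have := hT.isSphereSymmetric.neg_mem_openCell (hT.closedCell_subset s) hs' hx
      have := closedCell_subset_of_mem h' this
      rw [hs', Set.neg_subset] at this
      exact Or.inr this
  · rw [closedCell_projCell, closedCell_projCell]
    rintro (h | h)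
    · exact image_mono h
    · rintro _ ⟨x, hx, rfl⟩
      exact ⟨-x, h hx, veronese_neg x⟩

/-- Every cell of the quotient lying in `projCell t` has a representative lying in `t`. -/
theorem exists_projCell_eq {t : T.Cell} {c : (hT.projComplex hN).Cell}
    (h : (hT.projComplex hN).closedCell c ⊆ (hT.projComplex hN).closedCell (hT.projCell hN t)) :
    ∃ s, hT.projCell hN s = c ∧ T.closedCell s ⊆ T.closedCell t := by
  obtain ⟨s, rfl⟩ := hT.projCell_surjective hN c
  rcases (hT.projCell_subset_iff hN).1 h with h' | h'
  · exact ⟨s, rfl, h'⟩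
  · obtain ⟨s', hs'⟩ := hT.2 s
    exact ⟨s', (hT.projCell_eq_iff hN).2 (Or.inr hs'), by rwa [hs', Set.neg_subset]⟩

theorem veronese_mem_vertices_iff {x : EuclideanSpace ℝ (Fin k)} (hx : ‖x‖ = 1) :
    veronese x ∈ (hT.projComplex hN).vertices ↔ x ∈ T.vertices := by
  constructor
  · rintro ⟨c, hc, hxc⟩
    obtain ⟨s, rfl⟩ := hT.projCell_surjective hN c
    rw [dim_projCell] at hc
    rcases (hT.veronese_mem_iff hN).1 hxc with h | h
    · exact ⟨s, hc, h⟩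
    · have : -x ∈ T.vertices := ⟨s, hc, h⟩
      simpa using hT.isSphereSymmetric.neg_mem_vertices (by simpa using hx) this
  · rintro ⟨s, hs, hxs⟩
    exact ⟨hT.projCell hN s, by rwa [dim_projCell], (hT.veronese_mem_iff hN).2 (Or.inl hxs)⟩

/-- The vertex of the quotient represented by a vertex of the sphere. -/
def projVertex (x : T.vertices) : (hT.projComplex hN).vertices :=
  ⟨veronese x, (hT.veronese_mem_vertices_iff hN (hT.norm_vertex x)).2 x.2⟩

/-- The edge of the quotient represented by an edge of the sphere. -/
def projEdge (e : T.Edge) : (hT.projComplex hN).Edge :=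
  ⟨hT.projCell hN e.1, by rw [dim_projCell, e.2]⟩

theorem projEdge_eq_iff {e f : T.Edge} : hT.projEdge hN e = hT.projEdge hN f ↔
    T.closedCell e.1 = T.closedCell f.1 ∨ T.closedCell e.1 = -T.closedCell f.1 := by
  rw [← hT.projCell_eq_iff hN]
  exact Subtype.ext_iff

theorem projVertex_eq_iff {x y : T.vertices} :
    hT.projVertex hN x = hT.projVertex hN y ↔ veronese x.1 = veronese y.1 :=
  Subtype.ext_iff

theorem exists_projVertex_eq {s : T.Cell} {v : (hT.projComplex hN).vertices}
    (hv : v.1 ∈ (hT.projComplex hN).closedCell (hT.projCell hN s)) :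
    ∃ x : T.vertices, x.1 ∈ T.closedCell s ∧ hT.projVertex hN x = v := by
  have hv' := hv
  rw [closedCell_projCell] at hv'
  obtain ⟨x, hx, hxv⟩ := hv'
  have hxV : x ∈ T.vertices := by
    rw [← hT.veronese_mem_vertices_iff hN (hT.norm_eq_one hx), hxv]
    exact v.2
  exact ⟨⟨x, hxV⟩, hx, Subtype.ext hxv⟩

theorem projVertex_surjective : Function.Surjective (hT.projVertex hN) := by
  intro v
  obtain ⟨c, -, hc⟩ := v.2
  obtain ⟨s, rfl⟩ := hT.projCell_surjective hN c
  obtain ⟨x, -, hx⟩ := hT.exists_projVertex_eq hN hc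
  exact ⟨x, hx⟩

theorem joins_projEdge {e : T.Edge} {x y : T.vertices} (h : T.Joins e x y) :
    (hT.projComplex hN).Joins (hT.projEdge hN e) (hT.projVertex hN x) (hT.projVertex hN y) := by
  refine ⟨fun hxy => h.1 (Subtype.ext ?_), (hT.veronese_mem_iff hN).2 (Or.inl h.2.1),
    (hT.veronese_mem_iff hN).2 (Or.inl h.2.2)⟩
  exact hT.veronese_injOn hN e.1 h.2.1 h.2.2 ((hT.projVertex_eq_iff hN).1 hxy)

theorem exists_joins_of_projEdge {e : T.Edge} {u v : (hT.projComplex hN).vertices}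
    (h : (hT.projComplex hN).Joins (hT.projEdge hN e) u v) :
    ∃ x y, hT.projVertex hN x = u ∧ hT.projVertex hN y = v ∧ T.Joins e x y := by
  obtain ⟨x, hx, rfl⟩ := hT.exists_projVertex_eq hN h.2.1
  obtain ⟨y, hy, rfl⟩ := hT.exists_projVertex_eq hN h.2.2
  exact ⟨x, y, rfl, rfl, fun hxy => h.1 (congrArg _ hxy), hx, hy⟩

theorem polyhedron_projComplex :
    (hT.projComplex hN).polyhedron = veronese '' Metric.sphere 0 1 := by
  ext z
  rw [mem_polyhedron, ← hT.1]
  constructor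
  · rintro ⟨c, hc⟩
    obtain ⟨s, rfl⟩ := hT.projCell_surjective hN c
    rw [closedCell_projCell] at hc
    exact image_mono (closedCell_subset_polyhedron s) hc
  · rintro ⟨x, hx, rfl⟩
    obtain ⟨s, hs⟩ := mem_polyhedron.1 hx
    exact ⟨hT.projCell hN s, (hT.veronese_mem_iff hN).2 (Or.inl hs)⟩

end projComplex

end IsSymmetricSphereTriangulation

end GenSimplicialComplex

/-! ### Projective space as a subspace of a Euclidean space -/

/-- The Veronese map on the projective space. -/
def projVeronese {n : ℕ} (z : RealProjSpace n) : EuclideanSpace ℝ (Fin ((n + 1) * (n + 1))) :=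
  Quotient.lift (fun x : Metric.sphere (0 : EuclideanSpace ℝ (Fin (n + 1))) 1 => veronese x.1)
    (by
      rintro x y (h | h)
      · rw [h]
      · rw [h]
        exact veronese_neg _) z

theorem continuous_projVeronese {n : ℕ} : Continuous (projVeronese (n := n)) :=
  (continuous_veronese.comp continuous_subtype_val).quotient_lift _

theorem projVeronese_injective {n : ℕ} : Function.Injective (projVeronese (n := n)) := by
  intro a b
  induction a using Quotient.inductionOn with | _ x
  induction b using Quotient.inductionOn with | _ y
  intro h
  refine Quotient.sound ?_
  rcases veronese_eq_iff.1 (h : veronese x.1 = veronese y.1) with h | h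
  · exact Or.inl (Subtype.ext h)
  · exact Or.inr (Subtype.ext h)

theorem range_projVeronese {n : ℕ} : range (projVeronese (n := n)) =
    veronese '' Metric.sphere 0 1 := by
  ext z
  constructor
  · rintro ⟨a, rfl⟩
    induction a using Quotient.inductionOn with | _ x
    exact ⟨x.1, x.2, rfl⟩
  · rintro ⟨x, hx, rfl⟩
    exact ⟨Quotient.mk _ ⟨x, hx⟩, rfl⟩

instance {n : ℕ} : CompactSpace (RealProjSpace n) := Quotient.compactSpace

instance {n : ℕ} : T2Space (RealProjSpace n) :=
  T2Space.of_injective_continuous projVeronese_injective continuous_projVeronese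

theorem nonempty_homeomorph_realProjSpace {n : ℕ}
    {A : Set (EuclideanSpace ℝ (Fin ((n + 1) * (n + 1))))} (hA : A = veronese '' Metric.sphere 0 1) : Nonempty (A ≃ₜ RealProjSpace n) := by
  subst hA
  rw [← range_projVeronese]
  exact ⟨((continuous_projVeronese.isClosedEmbedding
    projVeronese_injective).isEmbedding.toHomeomorph).symm⟩

/-- Two graphs that are quotients of a common vertex set by the same equivalence relation, with
the same adjacencies, are isomorphic. -/
theorem SimpleGraph.nonempty_iso_of_surjective {A V W : Type*} {G : SimpleGraph V}
    {H : SimpleGraph W} {π : A → V} {ρ : A → W} (hπ : Function.Surjective π)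
    (hρ : Function.Surjective ρ) (heq : ∀ x y, π x = π y ↔ ρ x = ρ y)
    (hadj : ∀ x y, G.Adj (π x) (π y) ↔ H.Adj (ρ x) (ρ y)) : Nonempty (G ≃g H) := by
  have hg : ∀ x, ρ (Function.surjInv hπ (π x)) = ρ x := fun x =>
    (heq _ _).1 (Function.surjInv_eq hπ (π x))
  have hbij : Function.Bijective fun a => ρ (Function.surjInv hπ a) := by
    refine ⟨fun a b hab => ?_, fun w => ?_⟩
    · have := (heq _ _).2 hab
      rwa [Function.surjInv_eq hπ, Function.surjInv_eq hπ] at this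
    · obtain ⟨x, rfl⟩ := hρ w
      exact ⟨π x, hg x⟩
  refine ⟨⟨Equiv.ofBijective _ hbij, ?_⟩⟩
  · intro a b
    obtain ⟨x, rfl⟩ := hπ a
    obtain ⟨y, rfl⟩ := hπ b
    have he : ∀ x, Equiv.ofBijective _ hbij (π x) = ρ x := hg
    rw [he, he, hadj]

theorem EuclideanSpace.eq_or_eq_neg_of_norm_eq_one {x y : EuclideanSpace ℝ (Fin 1)}
    (hx : ‖x‖ = 1) (hy : ‖y‖ = 1) : x = y ∨ x = -y := by
  rw [← hy, EuclideanSpace.norm_eq, EuclideanSpace.norm_eq, Fin.sum_univ_one, Fin.sum_univ_one,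
    Real.sqrt_sq (norm_nonneg _), Real.sqrt_sq (norm_nonneg _)] at hx
  rcases abs_eq_abs.1 hx with h | h
  · left
    ext i
    rwa [Subsingleton.elim i 0]
  · right
    ext i
    rwa [Subsingleton.elim i 0]

/-! ### From a coloured sphere to a non-bipartite quadrangulation -/

namespace GenSimplicialComplex

section ProperColouring

variable {X : Type*} [TopologicalSpace X] [T2Space X] {K : GenSimplicialComplex X}

/-- If all edges with differently coloured ends in `c` have differently coloured ends in `d`, then
`c` and `d` agree on each cell up to a swap of colours, provided that `c` is proper. -/
theorem IsProperColouring.xor_eq_xor {c d : K.vertices → Bool} (hc : K.IsProperColouring c)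
    (hd : ∀ e u v, K.Joins e u v → c u ≠ c v → d u ≠ d v) (s : K.Cell) (u v : K.vertices)
    (hu : (u : X) ∈ K.closedCell s) (hv : (v : X) ∈ K.closedCell s) :
    (c u ^^ d u) = (c v ^^ d v) := by
  obtain ⟨t, ht, hst⟩ := exists_isMaximalCell s
  have key : ∀ a b : K.vertices, (a : X) ∈ K.closedCell t → (b : X) ∈ K.closedCell t →
      c a ≠ c b → d a ≠ d b := by
    intro a b ha hb hab
    obtain ⟨e, -, he⟩ := exists_edge (fun h => hab (congrArg c h)) ha hb
    exact hd e a b he hab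
  obtain ⟨a, b, ha, hb, hab⟩ := hc t ht
  have h1 := key a b ha hb hab
  -- Since `a` and `b` have different `c`-colours, each of `u` and `v` differs in `c` from one of
  -- them, and this forces its `d`-colour.
  have h2 := key u a (hst hu) ha
  have h3 := key u b (hst hu) hb
  have h4 := key v a (hst hv) ha
  have h5 := key v b (hst hv) hb
  revert h1 h2 h3 h4 h5 hab
  cases c u <;> cases c v <;> cases c a <;> cases c b <;> cases d u <;> cases d v <;>
    cases d a <;> cases d b <;> simp

end ProperColouring

namespace IsSymmetricSphereTriangulation

variable {n : ℕ} {T : GenSimplicialComplex (EuclideanSpace ℝ (Fin (n + 1)))}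
  (hT : T.IsSymmetricSphereTriangulation) (hN : T.NoAntipodalVertices)
  {c : T.vertices → Bool} {V : Type*} {G : SimpleGraph V} {conv : ParallelEdges}

include hT

theorem exists_cell : Nonempty T.Cell := by
  obtain ⟨x, hx⟩ := NormedSpace.sphere_nonempty (E := EuclideanSpace ℝ (Fin (n + 1))) (x := 0)
    (r := 1) |>.2 zero_le_one
  rw [← hT.1] at hx
  obtain ⟨s, -⟩ := mem_polyhedron.1 hx
  exact ⟨s⟩

include hN in
-- On `S^0` distinct points are antipodal, so no cell has two vertices and no colouring is proper.
-- Positivity of `n` makes the sphere connected.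
theorem dim_pos (hc : T.IsProperColouring c) : 1 ≤ n := by
  by_contra hn
  obtain rfl : n = 0 := by omega
  obtain ⟨s⟩ := hT.exists_cell
  obtain ⟨t, ht, -⟩ := exists_isMaximalCell s
  obtain ⟨u, v, hu, hv, huv⟩ := hc t ht
  refine hN t u v (hT.norm_vertex u) ?_ hu hv
  refine (EuclideanSpace.eq_or_eq_neg_of_norm_eq_one (hT.norm_vertex v)
    (hT.norm_vertex u)).resolve_left fun h => huv (congrArg c (Subtype.ext h.symm))

include hN in
-- A bipartition of `G` pulls back to a colouring `d` that takes equal values at antipodes. It would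
-- agree with `c` up to a global swap, while `c` separates antipodes.
theorem not_isBipartite (hc : T.IsProperColouring c) (ha : T.IsAntisymmetricColouring c)
    (hG : T.ObtainedByAntipodalIdentification conv (T.bichromaticEdges c) G) :
    ¬ G.IsBipartite := by
  rintro ⟨C⟩
  obtain ⟨π, -, hπ, hadj, -⟩ := hG
  let d : T.vertices → Bool := fun u => decide (C (π u) = 0)
  have hd : ∀ e u v, T.Joins e u v → c u ≠ c v → d u ≠ d v := by
    intro e u v he huv
    have h : C (π u) ≠ C (π v) := C.valid ((hadj _ _).2 ⟨e, ⟨u, v, he, huv⟩, u, v, he, rfl, rfl⟩)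
    simp only [d, ne_eq, decide_eq_decide]
    omega
  have hconn : IsPreconnected T.polyhedron := by
    rw [hT.1]
    refine isPreconnected_sphere ?_ 0 1
    rw [← Module.finrank_eq_rank, finrank_euclideanSpace_fin]
    have := hT.dim_pos hN hc
    exact_mod_cast (by omega : 1 < n + 1)
  obtain ⟨s⟩ := hT.exists_cell
  obtain ⟨u, -⟩ := exists_vertex_mem s
  have hu := hT.norm_vertex u
  let v : T.vertices := ⟨-u, hT.isSphereSymmetric.neg_mem_vertices hu u.2⟩
  have h1 := apply_eq_of_isPreconnected hconn (fun w => c w ^^ d w) (hc.xor_eq_xor hd) u v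
  have h2 : d u = d v := by
    simp only [d]
    rw [(hπ u v).2 (Or.inr ⟨hu, rfl⟩)]
  have h3 := ha u v hu rfl
  rw [h2] at h1
  exact h3 (Bool.xor_left_inj.1 h1)

/-- The antipode of a bichromatic edge is bichromatic. -/
theorem mem_bichromaticEdges_of_closedCell_eq_neg (ha : T.IsAntisymmetricColouring c)
    {e f : T.Edge} (he : e ∈ T.bichromaticEdges c) (hef : T.closedCell f.1 = -T.closedCell e.1) :
    f ∈ T.bichromaticEdges c := by
  obtain ⟨u, v, h, huv⟩ := he
  have hu := hT.norm_vertex u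
  have hv := hT.norm_vertex v
  let u' : T.vertices := ⟨-u, hT.isSphereSymmetric.neg_mem_vertices hu u.2⟩
  let v' : T.vertices := ⟨-v, hT.isSphereSymmetric.neg_mem_vertices hv v.2⟩
  refine ⟨u', v', ⟨?_, ?_, ?_⟩, ?_⟩
  · intro h'
    exact h.1 (Subtype.ext (neg_injective (congrArg Subtype.val h')))
  · rw [hef, Set.neg_mem_neg]
    exact h.2.1
  · rw [hef, Set.neg_mem_neg]
    exact h.2.2
  · have h1 := ha u u' hu rfl
    have h2 := ha v v' hv rfl
    revert h1 h2 huv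
    cases c u <;> cases c v <;> cases c u' <;> cases c v' <;> simp

omit hT in
-- A cell `t` containing `s` has the same class as `s`; it cannot be the antipode of `s`, since `s`
-- would then contain two antipodal points.
theorem isMaximalCell_of_projCell (hT : T.IsSymmetricSphereTriangulation)
    (hN : T.NoAntipodalVertices) {s : T.Cell}
    (hs : (hT.projComplex hN).IsMaximalCell (hT.projCell hN s)) : T.IsMaximalCell s := by
  intro t ht
  have := hs (hT.projCell hN t) ((hT.projCell_subset_iff hN).2 (Or.inl ht))
  rcases (hT.projCell_eq_iff hN).1 this with h | h
  · exact closedCell_injective h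
  · obtain ⟨x, hx⟩ := openCell_nonempty s
    have hxs := openCell_subset_closedCell s hx
    have := ht hxs
    rw [h, Set.mem_neg] at this
    exact absurd this (hT.isSphereSymmetric.neg_notMem_closedCell hN (hT.norm_eq_one hxs) hxs)

include hN in
theorem isQuadrangulationOf (hc : T.IsProperColouring c) (ha : T.IsAntisymmetricColouring c)
    (hG : T.ObtainedByAntipodalIdentification conv (T.bichromaticEdges c) G) :
    IsQuadrangulationOf conv G (RealProjSpace n) := by
  obtain ⟨π, hsurj, hπ, hadj, hpar⟩ := hG
  have hπ' : ∀ x y, π x = π y ↔ hT.projVertex hN x = hT.projVertex hN y := by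
    intro x y
    rw [hπ, projVertex_eq_iff, ← eq_or_eq_neg_iff_veronese, Subtype.ext_iff]
    simp [hT.norm_vertex x]
  refine ⟨_, hT.projComplex hN, hT.projEdge hN '' T.bichromaticEdges c,
    nonempty_homeomorph_realProjSpace (hT.polyhedron_projComplex hN), ?_, ?_, ?_⟩
  · intro q hq
    obtain ⟨s, rfl⟩ := hT.projCell_surjective hN q
    have hs := isMaximalCell_of_projCell hT hN hq
    have hinj : ∀ x y : T.vertices, x.1 ∈ T.closedCell s → y.1 ∈ T.closedCell s →
        hT.projVertex hN x = hT.projVertex hN y → x = y := fun x y hx hy h =>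
      Subtype.ext (hT.veronese_injOn hN s hx hy ((hT.projVertex_eq_iff hN).1 h))
    -- One side of the bipartition consists of the images of the vertices of `s` coloured `true`.
    -- The class of `s` has a second representative, so membership refers to the chosen `s`.
    let A : Set {v : (hT.projComplex hN).vertices //
        v.1 ∈ (hT.projComplex hN).closedCell (hT.projCell hN s)} :=
      {v | ∃ x : T.vertices, x.1 ∈ T.closedCell s ∧ hT.projVertex hN x = v.1 ∧ c x = true}
    have hA : ∀ (x : T.vertices) (hx : x.1 ∈ T.closedCell s) hv,
        (⟨hT.projVertex hN x, hv⟩ : {v : (hT.projComplex hN).vertices //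
        v.1 ∈ (hT.projComplex hN).closedCell (hT.projCell hN s)}) ∈ A ↔ c x = true := by
      intro x hx hv
      refine ⟨?_, fun h => ⟨x, hx, rfl, h⟩⟩
      rintro ⟨y, hy, hyx, hcy⟩
      rwa [hinj y x hy hx hyx] at hcy
    have hmem : ∀ x : T.vertices, x.1 ∈ T.closedCell s → (hT.projVertex hN x).1 ∈
        (hT.projComplex hN).closedCell (hT.projCell hN s) := fun x hx =>
      (hT.veronese_mem_iff hN).2 (Or.inl hx)
    refine ⟨A, ?_, ?_, ?_⟩
    · obtain ⟨u, v, hu, hv, huv⟩ := hc s hs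
      rcases Bool.eq_false_or_eq_true (c u) with h | h
      · exact ⟨⟨_, hmem u hu⟩, (hA u hu _).2 h⟩
      · refine ⟨⟨_, hmem v hv⟩, (hA v hv _).2 ?_⟩
        rw [h] at huv
        simpa using huv.symm
    · obtain ⟨u, v, hu, hv, huv⟩ := hc s hs
      rcases Bool.eq_false_or_eq_true (c u) with h | h
      · refine ⟨⟨_, hmem v hv⟩, fun h' => ?_⟩
        rw [hA v hv] at h'
        exact huv (h.trans h'.symm)
      · refine ⟨⟨_, hmem u hu⟩, fun h' => ?_⟩
        rw [hA u hu] at h'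
        simp [h] at h'
    · rintro ⟨u, hu⟩ ⟨v, hv⟩
      obtain ⟨x, hx, rfl⟩ := hT.exists_projVertex_eq hN hu
      obtain ⟨y, hy, rfl⟩ := hT.exists_projVertex_eq hN hv
      rw [hA x hx, hA y hy]
      have hxy : (c x = true ↔ ¬ c y = true) ↔ c x ≠ c y := by
        cases c x <;> cases c y <;> simp
      rw [hxy]
      constructor
      · rintro ⟨_, ⟨e, he, rfl⟩, hes, hj⟩
        -- The representative of the edge that lies in `s` may be the antipode of `e`, which is
        -- bichromatic too.
        obtain ⟨r, hre, hrs⟩ := hT.exists_projCell_eq hN hes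
        have hre' : T.closedCell r = T.closedCell e.1 ∨ T.closedCell r = -T.closedCell e.1 :=
          (hT.projCell_eq_iff hN).1 hre
        have hrd : T.dim r = 1 := by
          rcases hre' with h | h
          · rw [closedCell_injective h, e.2]
          · rw [hT.isSphereSymmetric.dim_eq (hT.closedCell_subset _) h, e.2]
        let f : T.Edge := ⟨r, hrd⟩
        have hf : f ∈ T.bichromaticEdges c := by
          rcases hre' with h | h
          · rwa [show f = e from Subtype.ext (closedCell_injective h)]
          · exact hT.mem_bichromaticEdges_of_closedCell_eq_neg ha he h
        have hfe : hT.projEdge hN f = hT.projEdge hN e := Subtype.ext hre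
        rw [← hfe] at hj
        obtain ⟨x', y', hx', hy', hj'⟩ := hT.exists_joins_of_projEdge hN hj
        obtain rfl := hinj x' x (hrs hj'.2.1) hx hx'
        obtain rfl := hinj y' y (hrs hj'.2.2) hy hy'
        exact hj'.mem_bichromaticEdges_iff.1 hf
      · intro hne
        obtain ⟨e, hes, he⟩ := exists_edge (fun h => hne (congrArg c h)) hx hy
        exact ⟨_, ⟨e, ⟨x, y, he, hne⟩, rfl⟩, (hT.projCell_subset_iff hN).2 (Or.inl hes),
          hT.joins_projEdge hN he⟩
  · rintro hconv _ ⟨e, he, rfl⟩ _ ⟨f, hf, rfl⟩ u v heu hfu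
    obtain ⟨x, y, rfl, rfl, hj⟩ := hT.exists_joins_of_projEdge hN heu
    obtain ⟨x', y', hx, hy, hj'⟩ := hT.exists_joins_of_projEdge hN hfu
    rcases hpar hconv e he f hf x y x' y' hj hj' ((hπ' _ _).2 hx.symm) ((hπ' _ _).2 hy.symm)
      with rfl | ⟨-, h⟩
    · rfl
    · exact (hT.projEdge_eq_iff hN).2 (Or.inr (by rw [h, neg_neg]))
  · refine SimpleGraph.nonempty_iso_of_surjective hsurj (hT.projVertex_surjective hN) hπ' ?_
    intro x y
    rw [hadj]
    constructor
    · rintro ⟨e, he, u, v, hj, hu, hv⟩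
      rw [hπ'] at hu hv
      exact ⟨_, ⟨e, he, rfl⟩, hu ▸ hv ▸ hT.joins_projEdge hN hj⟩
    · rintro ⟨_, ⟨e, he, rfl⟩, hj⟩
      obtain ⟨u, v, hu, hv, hj'⟩ := hT.exists_joins_of_projEdge hN hj
      exact ⟨e, he, u, v, hj', (hπ' _ _).2 hu, (hπ' _ _).2 hv⟩

end IsSymmetricSphereTriangulation

end GenSimplicialComplex

theorem ArisesFromSphere.isQuadrangulationOf {conv : ParallelEdges} {V : Type*}
    {G : SimpleGraph V} {n : ℕ} (h : ArisesFromSphere conv G n) :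
    IsQuadrangulationOf conv G (RealProjSpace n) ∧ ¬ G.IsBipartite := by
  obtain ⟨T, hT, hN, c, hc, ha, hG⟩ := h
  exact ⟨hT.isQuadrangulationOf hN hc ha hG, hT.not_isBipartite hN hc ha hG⟩

/-! ### Vertical projection between the ball and the hemispheres -/

section Hemisphere

variable {n : ℕ}

/-- The map of the unit ball onto the upper hemisphere that is vertical over the equator. -/
noncomputable def hemisphere (x : EuclideanSpace ℝ (Fin n)) : EuclideanSpace ℝ (Fin (n + 1)) :=
  WithLp.toLp 2 (Fin.cons (√(1 - ‖x‖ ^ 2)) fun i => x i)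

/-- The vertical projection, which forgets the height coordinate. -/
def flatten (z : EuclideanSpace ℝ (Fin (n + 1))) : EuclideanSpace ℝ (Fin n) :=
  WithLp.toLp 2 fun i => z i.succ

theorem continuous_flatten : Continuous (flatten (n := n)) := by
  unfold flatten
  fun_prop

theorem continuous_hemisphere : Continuous (hemisphere (n := n)) := by
  refine (PiLp.continuous_toLp 2 _).comp (continuous_pi fun i => ?_)
  refine Fin.cases ?_ (fun i => ?_) i
  · simp only [Fin.cons_zero]
    fun_prop
  · simp only [Fin.cons_succ]
    fun_prop

@[simp] theorem flatten_hemisphere (x : EuclideanSpace ℝ (Fin n)) : flatten (hemisphere x) = x :=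
  rfl

theorem hemisphere_zero (x : EuclideanSpace ℝ (Fin n)) : hemisphere x 0 = √(1 - ‖x‖ ^ 2) := rfl

theorem hemisphere_injective : Function.Injective (hemisphere (n := n)) :=
  Function.LeftInverse.injective flatten_hemisphere

theorem norm_sq_eq_add_norm_flatten_sq (z : EuclideanSpace ℝ (Fin (n + 1))) :
    ‖z‖ ^ 2 = z 0 ^ 2 + ‖flatten z‖ ^ 2 := by
  rw [EuclideanSpace.norm_sq_eq, EuclideanSpace.norm_sq_eq, Fin.sum_univ_succ, Real.norm_eq_abs,
    sq_abs]
  rfl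

theorem norm_flatten_le (z : EuclideanSpace ℝ (Fin (n + 1))) : ‖flatten z‖ ≤ ‖z‖ := by
  rw [← sq_le_sq₀ (norm_nonneg _) (norm_nonneg _), norm_sq_eq_add_norm_flatten_sq z]
  linarith [sq_nonneg (z 0)]

theorem norm_hemisphere {x : EuclideanSpace ℝ (Fin n)} (hx : ‖x‖ ≤ 1) : ‖hemisphere x‖ = 1 := by
  have h : 0 ≤ 1 - ‖x‖ ^ 2 := by nlinarith [norm_nonneg x]
  have := norm_sq_eq_add_norm_flatten_sq (hemisphere x)
  rw [hemisphere_zero, Real.sq_sqrt h, flatten_hemisphere, sub_add_cancel] at this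
  exact (pow_eq_one_iff_of_nonneg (norm_nonneg _) two_ne_zero).1 this

theorem hemisphere_flatten {z : EuclideanSpace ℝ (Fin (n + 1))} (hz : ‖z‖ = 1) (h0 : 0 ≤ z 0) :
    hemisphere (flatten z) = z := by
  have := norm_sq_eq_add_norm_flatten_sq z
  rw [hz, one_pow] at this
  ext i
  refine Fin.cases ?_ (fun i => rfl) i
  rw [hemisphere_zero, this, add_sub_cancel_right, Real.sqrt_sq h0]

theorem hemisphere_neg {x : EuclideanSpace ℝ (Fin n)} (hx : ‖x‖ = 1) :
    hemisphere (-x) = -hemisphere x := by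
  ext i
  refine Fin.cases ?_ (fun i => rfl) i
  rw [PiLp.neg_apply, hemisphere_zero, hemisphere_zero, norm_neg, hx]
  simp

/-- Heights are nonnegative, so opposite heights both vanish. The bound on `x` is needed because the
square root takes the default value `0` outside the ball. -/
theorem hemisphere_eq_neg_iff {x y : EuclideanSpace ℝ (Fin n)} (hx : ‖x‖ ≤ 1) :
    hemisphere y = -hemisphere x ↔ ‖x‖ = 1 ∧ y = -x := by
  constructor
  · intro h
    have hyx : y = -x := congrArg flatten h
    have h0 : hemisphere y 0 = -hemisphere x 0 := congrArg (fun z => z.ofLp 0) h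
    rw [hyx, hemisphere_zero, hemisphere_zero, norm_neg, self_eq_neg] at h0
    have h1 : 0 ≤ 1 - ‖x‖ ^ 2 := by nlinarith [norm_nonneg x]
    rw [Real.sqrt_eq_zero h1] at h0
    refine ⟨?_, hyx⟩
    exact (pow_eq_one_iff_of_nonneg (norm_nonneg _) two_ne_zero).1 (by linarith)
  · rintro ⟨h, rfl⟩
    exact hemisphere_neg h

end Hemisphere

/-! ### Doubling a boundary-symmetric triangulation of the ball -/

namespace GenSimplicialComplex

variable {n : ℕ} {T : GenSimplicialComplex (EuclideanSpace ℝ (Fin n))}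

namespace IsBoundarySymmetricBallTriangulation

theorem norm_le_one (hT : T.IsBoundarySymmetricBallTriangulation) {s : T.Cell}
    {x : EuclideanSpace ℝ (Fin n)} (hx : x ∈ T.closedCell s) : ‖x‖ ≤ 1 := by
  have := closedCell_subset_polyhedron s hx
  rw [hT.1] at this
  simpa using this

theorem norm_vertex_le_one (hT : T.IsBoundarySymmetricBallTriangulation) (x : T.vertices) :
    ‖x.1‖ ≤ 1 := by
  obtain ⟨p, -, hp⟩ := x.2
  exact hT.norm_le_one hp

/-- The cells of the double of `T`: each cell of `T` in the upper hemisphere, and each cell not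
lying in the boundary also in the lower hemisphere. -/
abbrev DoubleCell (T : GenSimplicialComplex (EuclideanSpace ℝ (Fin n))) : Type :=
  T.Cell ⊕ {s : T.Cell // ¬ T.closedCell s ⊆ Metric.sphere 0 1}

/-- The cell of the ball from which a cell of the double arises. -/
def DoubleCell.base : DoubleCell T → T.Cell := Sum.elim id Subtype.val

/-- The map of the ball to the hemisphere in which a cell of the double lies. -/
noncomputable def DoubleCell.lift :
    DoubleCell T → EuclideanSpace ℝ (Fin n) → EuclideanSpace ℝ (Fin (n + 1)) :=
  Sum.elim (fun _ => hemisphere) (fun _ x => -hemisphere x)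

theorem DoubleCell.lift_eq_or (c : DoubleCell T) :
    c.lift = hemisphere ∨ c.lift = fun x => -hemisphere x := by
  rcases c with s | s
  exacts [Or.inl rfl, Or.inr rfl]

theorem DoubleCell.continuous_lift (c : DoubleCell T) : Continuous c.lift := by
  rcases c.lift_eq_or with h | h <;> rw [h]
  exacts [continuous_hemisphere, continuous_hemisphere.neg]

theorem DoubleCell.lift_injective (c : DoubleCell T) : Function.Injective c.lift := by
  rcases c.lift_eq_or with h | h <;> rw [h]
  exacts [hemisphere_injective, neg_injective.comp hemisphere_injective]

theorem image_hemisphere_neg {A : Set (EuclideanSpace ℝ (Fin n))} (hA : A ⊆ Metric.sphere 0 1) :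
    hemisphere '' (-A) = (fun x => -hemisphere x) '' A := by
  rw [← Set.image_neg_eq_neg, image_image]
  exact image_congr fun x hx => hemisphere_neg (by simpa using hA hx)

/-- Every cell of the ball has a copy in the lower hemisphere. -/
theorem exists_lower_cell (hT : T.IsBoundarySymmetricBallTriangulation) (t : T.Cell) :
    ∃ c : DoubleCell T, T.dim c.base = T.dim t ∧
      c.lift '' T.openCell c.base = (fun x => -hemisphere x) '' T.openCell t ∧
      c.lift '' T.closedCell c.base = (fun x => -hemisphere x) '' T.closedCell t := by
  by_cases ht : T.closedCell t ⊆ Metric.sphere 0 1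
  · obtain ⟨t', ht'⟩ := hT.isSphereSymmetric.2 t ht
    -- On the equator the lower copy of `t` is the upper copy of its antipode, so boundary cells are
    -- not duplicated.
    refine ⟨Sum.inl t', hT.isSphereSymmetric.dim_eq ht ht', ?_, ?_⟩
    · rw [← image_hemisphere_neg ((openCell_subset_closedCell t).trans ht),
        ← hT.isSphereSymmetric.openCell_eq_neg ht ht']
      rfl
    · rw [← image_hemisphere_neg ht, ← ht']
      rfl
  · exact ⟨Sum.inr ⟨t, ht⟩, rfl, rfl, rfl⟩

theorem exists_doubleCell (hT : T.IsBoundarySymmetricBallTriangulation) (c : DoubleCell T)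
    (t : T.Cell) : ∃ c' : DoubleCell T, T.dim c'.base = T.dim t ∧
      c'.lift '' T.openCell c'.base = c.lift '' T.openCell t := by
  rcases c with s | s
  · exact ⟨Sum.inl t, rfl, rfl⟩
  · obtain ⟨c', h1, h2, -⟩ := hT.exists_lower_cell t
    exact ⟨c', h1, h2⟩

/-- The sphere is a subcomplex, so an open simplex that meets it belongs to a boundary cell. Hence
the lower copy of any other open simplex avoids the upper hemisphere. -/
theorem hemisphere_ne_neg (hT : T.IsBoundarySymmetricBallTriangulation) {t : T.Cell}
    (ht : ¬ T.closedCell t ⊆ Metric.sphere 0 1) {x y : EuclideanSpace ℝ (Fin n)}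
    (hy : y ∈ T.openCell t) : hemisphere x ≠ -hemisphere y := by
  intro h
  have hy' := ((hemisphere_eq_neg_iff (hT.norm_le_one (openCell_subset_closedCell t hy))).1 h).1
  exact ht (hT.isSphereSymmetric.closedCell_subset_sphere hy' hy)

/-- The triangulation of the sphere obtained by putting copies of a boundary-symmetric
triangulation of the ball on the two hemispheres. -/
noncomputable def double (hT : T.IsBoundarySymmetricBallTriangulation) :
    GenSimplicialComplex (EuclideanSpace ℝ (Fin (n + 1))) where
  Cell := DoubleCell T
  finite_cell := by
    have := T.finite_cell
    infer_instance
  dim c := T.dim c.base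
  char c := c.lift ∘ T.char c.base
  continuous_char c := c.continuous_lift.comp (T.continuous_char _)
  injective_char c := c.lift_injective.comp (T.injective_char _)
  exists_face c S hS := by
    obtain ⟨t, hd, ht⟩ := T.exists_face c.base S hS
    obtain ⟨c', h1, h2⟩ := hT.exists_doubleCell c t
    refine ⟨c', by rw [h1, hd], ?_⟩
    rw [image_comp, image_comp, ← ht]
    exact h2
  disjoint_openCell c c' hcc := by
    rw [image_comp, image_comp, disjoint_left]
    rintro _ ⟨x, hx, rfl⟩ ⟨y, hy, hxy⟩
    change x ∈ T.openCell _ at hx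
    change y ∈ T.openCell _ at hy
    rcases c with s | s <;> rcases c' with t | t
    · obtain rfl : y = x := hemisphere_injective hxy
      exact hcc (congrArg _ (eq_of_mem_openCell hx hy))
    · exact hT.hemisphere_ne_neg t.2 hy hxy.symm
    · exact hT.hemisphere_ne_neg s.2 hx hxy
    · obtain rfl : y = x := hemisphere_injective (neg_injective hxy)
      exact hcc (congrArg _ (Subtype.ext (eq_of_mem_openCell hx hy)))

variable (hT : T.IsBoundarySymmetricBallTriangulation)

theorem closedCell_double (c : DoubleCell T) :
    hT.double.closedCell c = c.lift '' T.closedCell c.base :=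
  range_comp c.lift (T.char c.base)

theorem exists_closedCell_double_eq_neg (c : DoubleCell T) :
    ∃ c' : DoubleCell T, hT.double.closedCell c' = -hT.double.closedCell c := by
  rcases c with s | s
  · obtain ⟨c', -, -, h⟩ := hT.exists_lower_cell s
    refine ⟨c', ?_⟩
    rw [closedCell_double, h, closedCell_double, ← Set.image_neg_eq_neg, image_image]
    rfl
  · refine ⟨Sum.inl s.1, ?_⟩
    rw [closedCell_double, closedCell_double, ← Set.image_neg_eq_neg, image_image]
    exact image_congr fun x _ => (neg_neg _).symm

theorem norm_lift {c : DoubleCell T} {x : EuclideanSpace ℝ (Fin n)} (hx : ‖x‖ ≤ 1) :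
    ‖c.lift x‖ = 1 := by
  rcases c.lift_eq_or with h | h <;> rw [h]
  · exact norm_hemisphere hx
  · rw [norm_neg, norm_hemisphere hx]

theorem isSymmetricSphereTriangulation_double : hT.double.IsSymmetricSphereTriangulation := by
  refine ⟨subset_antisymm (fun z hz => ?_) fun z hz => ?_, hT.exists_closedCell_double_eq_neg⟩
  · obtain ⟨c, hc⟩ := mem_polyhedron.1 hz
    obtain ⟨x, hx, rfl⟩ := (hT.closedCell_double c).subset hc
    exact mem_sphere_zero_iff_norm.2 (norm_lift (hT.norm_le_one hx))
  · have key : ∀ w : EuclideanSpace ℝ (Fin (n + 1)), ‖w‖ = 1 → 0 ≤ w 0 →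
        ∃ s : T.Cell, w ∈ hT.double.closedCell (Sum.inl s : DoubleCell T) := by
      intro w hw h0
      have : flatten w ∈ T.polyhedron := by
        rw [hT.1]
        simpa [hw] using norm_flatten_le w
      obtain ⟨s, hs⟩ := mem_polyhedron.1 this
      refine ⟨s, ?_⟩
      rw [closedCell_double]
      exact ⟨_, hs, hemisphere_flatten hw h0⟩
    have hz : ‖z‖ = 1 := by simpa using hz
    rw [mem_polyhedron]
    rcases le_total 0 (z 0) with h0 | h0
    · obtain ⟨s, hs⟩ := key z hz h0
      exact ⟨_, hs⟩
    · obtain ⟨s, hs⟩ := key (-z) (by rwa [norm_neg]) (by simpa using h0)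
      obtain ⟨c, hc⟩ := hT.exists_closedCell_double_eq_neg (Sum.inl s)
      exact ⟨c, by rw [hc, Set.mem_neg]; exact hs⟩

theorem exists_vertex_lift_eq {c : DoubleCell T} {z : EuclideanSpace ℝ (Fin (n + 1))}
    (hz : z ∈ hT.double.vertices) (hc : z ∈ hT.double.closedCell c) :
    ∃ x : T.vertices, x.1 ∈ T.closedCell c.base ∧ z = c.lift x := by
  obtain ⟨i, rfl⟩ := exists_char_vertex_eq hz hc
  exact ⟨⟨_, char_vertex_mem_vertices c.base i⟩, mem_range_self _, rfl⟩

theorem lift_mem_vertices {c : DoubleCell T} (x : T.vertices) (hx : x.1 ∈ T.closedCell c.base) :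
    c.lift x ∈ hT.double.vertices := by
  obtain ⟨i, hi⟩ := exists_char_vertex_eq x.2 hx
  rw [← hi]
  exact char_vertex_mem_vertices (K := hT.double) c i

theorem lift_mem_closedCell {c : DoubleCell T} {x : EuclideanSpace ℝ (Fin n)}
    (hx : x ∈ T.closedCell c.base) : c.lift x ∈ hT.double.closedCell c := by
  rw [closedCell_double]
  exact mem_image_of_mem _ hx

theorem exists_eq_hemisphere (z : hT.double.vertices) :
    ∃ x : T.vertices, z.1 = hemisphere x ∨ z.1 = -hemisphere x := by
  obtain ⟨c, -, hc⟩ := z.2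
  obtain ⟨x, -, hx⟩ := hT.exists_vertex_lift_eq z.2 hc
  refine ⟨x, ?_⟩
  rcases DoubleCell.lift_eq_or c with h | h <;> rw [h] at hx
  exacts [Or.inl hx, Or.inr hx]

/-- The vertex of the ball from which a vertex of the double arises. -/
noncomputable def baseVertex (z : hT.double.vertices) : T.vertices :=
  (hT.exists_eq_hemisphere z).choose

theorem baseVertex_spec (z : hT.double.vertices) :
    z.1 = hemisphere (hT.baseVertex z).1 ∨ z.1 = -hemisphere (hT.baseVertex z).1 :=
  (hT.exists_eq_hemisphere z).choose_spec

/-- The colouring of the double of the ball induced by a colouring of the ball. -/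
noncomputable def doubleColouring (c : T.vertices → Bool) (z : hT.double.vertices) : Bool :=
  open Classical in
  if z.1 = hemisphere (hT.baseVertex z).1 then c (hT.baseVertex z) else !c (hT.baseVertex z)

variable {c : T.vertices → Bool}

/-- Over the equator the chosen base vertex may be the antipode of `x`; boundary antisymmetry
compensates for the exchange of colours. -/
theorem doubleColouring_of_eq (hc : T.IsAntisymmetricColouring c) {z : hT.double.vertices}
    {x : T.vertices} (hz : z.1 = hemisphere x.1) : hT.doubleColouring c z = c x := by
  unfold doubleColouring
  split_ifs with h
  · rw [show hT.baseVertex z = x from Subtype.ext (hemisphere_injective (h.symm.trans hz))]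
  · have h' := (hT.baseVertex_spec z).resolve_left h
    obtain ⟨h1, h2⟩ := (hemisphere_eq_neg_iff (hT.norm_vertex_le_one _)).1 (hz.symm.trans h')
    have := hc (hT.baseVertex z) x h1 h2
    revert this
    cases c x <;> cases c (hT.baseVertex z) <;> simp

theorem doubleColouring_of_eq_neg (hc : T.IsAntisymmetricColouring c) {z : hT.double.vertices}
    {x : T.vertices} (hz : z.1 = -hemisphere x.1) : hT.doubleColouring c z = !c x := by
  unfold doubleColouring
  split_ifs with h
  · obtain ⟨h1, h2⟩ := (hemisphere_eq_neg_iff (hT.norm_vertex_le_one _)).1 (h.symm.trans hz)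
    have := hc x (hT.baseVertex z) h1 h2
    revert this
    cases c x <;> cases c (hT.baseVertex z) <;> simp
  · have h' := (hT.baseVertex_spec z).resolve_left h
    rw [show hT.baseVertex z = x from
      Subtype.ext (hemisphere_injective (neg_injective (h'.symm.trans hz)))]

theorem doubleColouring_lift_ne_iff (hc : T.IsAntisymmetricColouring c) {q : DoubleCell T}
    {z w : hT.double.vertices} {x y : T.vertices} (hz : z.1 = q.lift x) (hw : w.1 = q.lift y) :
    hT.doubleColouring c z ≠ hT.doubleColouring c w ↔ c x ≠ c y := by
  rcases q.lift_eq_or with h | h <;> rw [h] at hz hw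
  · rw [hT.doubleColouring_of_eq hc hz, hT.doubleColouring_of_eq hc hw]
  · rw [hT.doubleColouring_of_eq_neg hc hz, hT.doubleColouring_of_eq_neg hc hw]
    cases c x <;> cases c y <;> simp

theorem noAntipodalVertices_double (hN : T.NoAntipodalVertices) :
    hT.double.NoAntipodalVertices := by
  intro q u v hu hvu huq hvq
  obtain ⟨x, hx, hxu⟩ := hT.exists_vertex_lift_eq u.2 huq
  obtain ⟨y, hy, hyv⟩ := hT.exists_vertex_lift_eq v.2 hvq
  rw [hxu, hyv] at hvu
  have h : hemisphere y.1 = -hemisphere x.1 := by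
    rcases DoubleCell.lift_eq_or q with h | h <;> rw [h] at hvu
    · exact hvu
    · exact neg_injective hvu
  obtain ⟨h1, h2⟩ := (hemisphere_eq_neg_iff (hT.norm_vertex_le_one x)).1 h
  exact hN _ x y h1 h2 hx hy

theorem isMaximalCell_base {q : DoubleCell T} (hq : hT.double.IsMaximalCell q) :
    T.IsMaximalCell q.base := by
  intro t ht
  rcases q with s | s
  · have := hq (Sum.inl t : DoubleCell T) (by
      rw [closedCell_double, closedCell_double]
      exact image_mono ht)
    exact Sum.inl_injective this
  · have hts : ¬ T.closedCell t ⊆ Metric.sphere 0 1 := fun h => s.2 (ht.trans h)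
    have := hq (Sum.inr ⟨t, hts⟩ : DoubleCell T) (by
      rw [closedCell_double, closedCell_double]
      exact image_mono ht)
    exact congrArg Subtype.val (Sum.inr_injective this)

theorem isProperColouring_double (hc : T.IsAntisymmetricColouring c)
    (hp : T.IsProperColouring c) : hT.double.IsProperColouring (hT.doubleColouring c) := by
  intro q hq
  obtain ⟨x, y, hx, hy, hxy⟩ := hp _ (hT.isMaximalCell_base hq)
  exact ⟨⟨_, hT.lift_mem_vertices x hx⟩, ⟨_, hT.lift_mem_vertices y hy⟩,
    hT.lift_mem_closedCell hx, hT.lift_mem_closedCell hy,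
    (hT.doubleColouring_lift_ne_iff hc rfl rfl).2 hxy⟩

theorem isAntisymmetricColouring_double (hc : T.IsAntisymmetricColouring c) :
    hT.double.IsAntisymmetricColouring (hT.doubleColouring c) := by
  intro u v _ hvu
  rcases hT.baseVertex_spec u with h | h
  · rw [hT.doubleColouring_of_eq hc h, hT.doubleColouring_of_eq_neg hc (hvu.trans (by rw [h]))]
    simp
  · rw [hT.doubleColouring_of_eq_neg hc h,
      hT.doubleColouring_of_eq hc (hvu.trans (by rw [h, neg_neg]))]
    simp

/-- The edge of the ball from which an edge of the double arises. -/
def baseEdge (e : hT.double.Edge) : T.Edge := ⟨DoubleCell.base e.1, e.2⟩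

theorem exists_joins_baseEdge {e : hT.double.Edge} {u v : hT.double.vertices}
    (h : hT.double.Joins e u v) : ∃ x y, T.Joins (hT.baseEdge e) x y ∧
      u.1 = DoubleCell.lift e.1 x.1 ∧ v.1 = DoubleCell.lift e.1 y.1 := by
  obtain ⟨x, hx, hxu⟩ := hT.exists_vertex_lift_eq u.2 h.2.1
  obtain ⟨y, hy, hyv⟩ := hT.exists_vertex_lift_eq v.2 h.2.2
  exact ⟨x, y, ⟨fun hxy => h.1 (Subtype.ext (by rw [hxu, hyv, hxy])), hx, hy⟩, hxu, hyv⟩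

/-- This transfers the ban on parallel edges: edges of the ball that may coincide after
identification have copies that are equal or antipodal. -/
theorem eq_or_closedCell_eq_neg_of_base {p q : DoubleCell T}
    (h : p.base = q.base ∨ (T.closedCell p.base ⊆ Metric.sphere 0 1 ∧
      T.closedCell q.base = -T.closedCell p.base)) :
    p = q ∨ hT.double.closedCell q = -hT.double.closedCell p := by
  rw [closedCell_double, closedCell_double, ← Set.image_neg_eq_neg, image_image]
  rcases h with h | ⟨h1, h2⟩
  · rcases p with s | s <;> rcases q with t | t
    · exact Or.inl (congrArg _ h)
    · obtain rfl : s = t.1 := h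
      exact Or.inr rfl
    · obtain rfl : s.1 = t := h
      exact Or.inr (image_congr fun x _ => (neg_neg _).symm)
    · exact Or.inl (congrArg _ (Subtype.ext h))
  · rcases p with s | s
    · rcases q with t | t
      · right
        rw [h2]
        exact image_hemisphere_neg h1
      · exact absurd (h2 ▸ neg_subset_sphere h1) t.2
    · exact absurd h1 s.2

theorem obtainedByAntipodalIdentification_double {conv : ParallelEdges} {V : Type*}
    {G : SimpleGraph V} (hc : T.IsAntisymmetricColouring c)
    (hG : T.ObtainedByAntipodalIdentification conv (T.bichromaticEdges c) G) :
    hT.double.ObtainedByAntipodalIdentification conv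
      (hT.double.bichromaticEdges (hT.doubleColouring c)) G := by
  obtain ⟨π, hsurj, hπ, hadj, hpar⟩ := hG
  have hS := hT.isSymmetricSphereTriangulation_double
  -- The vertex of `G` assigned to `z` does not depend on the choice of base vertex, because `π`
  -- already identifies antipodal boundary vertices.
  have hbase : ∀ (z : hT.double.vertices) (x : T.vertices),
      (z.1 = hemisphere x ∨ z.1 = -hemisphere x) → π (hT.baseVertex z) = π x := by
    intro z x hz
    rw [hπ]
    rcases hT.baseVertex_spec z with h | h <;> rcases hz with h' | h' <;> rw [h] at h'
    · exact Or.inl (Subtype.ext (hemisphere_injective h'))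
    · rw [← neg_eq_iff_eq_neg, eq_comm] at h'
      exact Or.inr ((hemisphere_eq_neg_iff (hT.norm_vertex_le_one _)).1 h')
    · exact Or.inr ((hemisphere_eq_neg_iff (hT.norm_vertex_le_one _)).1 h'.symm)
    · exact Or.inl (Subtype.ext (hemisphere_injective (neg_injective h')))
  have hlift : ∀ (q : DoubleCell T) (z : hT.double.vertices) (x : T.vertices),
      z.1 = q.lift x → π (hT.baseVertex z) = π x := by
    intro q z x hz
    apply hbase
    rcases q.lift_eq_or with h | h <;> rw [h] at hz
    exacts [Or.inl hz, Or.inr hz]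
  refine ⟨fun z => π (hT.baseVertex z), ?_, ?_, ?_, ?_⟩
  · intro a
    obtain ⟨x, rfl⟩ := hsurj a
    obtain ⟨p, -, hp⟩ := x.2
    exact ⟨⟨_, hT.lift_mem_vertices (c := Sum.inl p) x hp⟩, hlift (Sum.inl p) _ x rfl⟩
  · intro u v
    constructor
    · intro h
      have h' : v.1 = u.1 ∨ v.1 = -u.1 := by
        rcases (hπ _ _).1 h with h | ⟨h1, h2⟩
        · rcases hT.baseVertex_spec u with hu | hu <;> rcases hT.baseVertex_spec v with hv | hv <;>
            rw [hu, hv, h] <;> simp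
        · rcases hT.baseVertex_spec u with hu | hu <;> rcases hT.baseVertex_spec v with hv | hv <;>
            rw [hu, hv, h2, hemisphere_neg h1] <;> simp
      rcases h' with h' | h'
      exacts [Or.inl (Subtype.ext h'.symm), Or.inr ⟨hS.norm_vertex u, h'⟩]
    · rintro (rfl | ⟨-, h⟩)
      · rfl
      · apply hbase
        rw [← neg_eq_iff_eq_neg, eq_comm] at h
        rw [h]
        rcases hT.baseVertex_spec v with hv | hv <;> rw [hv] <;> simp
  · intro a b
    rw [hadj]
    constructor
    · rintro ⟨e, he, x, y, hj, rfl, rfl⟩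
      let e' : hT.double.Edge := ⟨(Sum.inl e.1 : DoubleCell T), e.2⟩
      let x' : hT.double.vertices := ⟨_, hT.lift_mem_vertices (c := Sum.inl e.1) x hj.2.1⟩
      let y' : hT.double.vertices := ⟨_, hT.lift_mem_vertices (c := Sum.inl e.1) y hj.2.2⟩
      have hj' : hT.double.Joins e' x' y' :=
        ⟨fun h => hj.1 (Subtype.ext (hemisphere_injective (congrArg Subtype.val h))),
          hT.lift_mem_closedCell (c := Sum.inl e.1) hj.2.1,
          hT.lift_mem_closedCell (c := Sum.inl e.1) hj.2.2⟩
      refine ⟨e', hj'.mem_bichromaticEdges_iff.2 ?_, x', y', hj', hlift (Sum.inl e.1) _ _ rfl,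
        hlift (Sum.inl e.1) _ _ rfl⟩
      exact (hT.doubleColouring_lift_ne_iff hc (q := Sum.inl e.1) rfl rfl).2
        (hj.mem_bichromaticEdges_iff.1 he)
    · rintro ⟨e, he, u, v, hj, rfl, rfl⟩
      obtain ⟨x, y, hj', hx, hy⟩ := hT.exists_joins_baseEdge hj
      refine ⟨_, hj'.mem_bichromaticEdges_iff.2 ?_, x, y, hj', (hlift _ _ _ hx).symm,
        (hlift _ _ _ hy).symm⟩
      exact (hT.doubleColouring_lift_ne_iff hc hx hy).1 (hj.mem_bichromaticEdges_iff.1 he)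
  · intro hconv e he f hf u v u' v' hju hju' hu hv
    obtain ⟨x, y, hj, hx, hy⟩ := hT.exists_joins_baseEdge hju
    obtain ⟨x', y', hj', hx', hy'⟩ := hT.exists_joins_baseEdge hju'
    dsimp only at hu hv
    rw [hlift _ _ _ hx, hlift _ _ _ hx'] at hu
    rw [hlift _ _ _ hy, hlift _ _ _ hy'] at hv
    have he' := hj.mem_bichromaticEdges_iff.2
      ((hT.doubleColouring_lift_ne_iff hc hx hy).1 (hju.mem_bichromaticEdges_iff.1 he))
    have hf' := hj'.mem_bichromaticEdges_iff.2
      ((hT.doubleColouring_lift_ne_iff hc hx' hy').1 (hju'.mem_bichromaticEdges_iff.1 hf))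
    have := hpar hconv _ he' _ hf' x y x' y' hj hj' hu hv
    rcases hT.eq_or_closedCell_eq_neg_of_base (p := e.1) (q := f.1)
      (this.imp_left (congrArg Subtype.val)) with h | h
    · exact Or.inl (Subtype.ext h)
    · exact Or.inr ⟨hS.closedCell_subset _, h⟩

end IsBoundarySymmetricBallTriangulation

end GenSimplicialComplex

theorem ArisesFromBall.arisesFromSphere {conv : ParallelEdges} {V : Type*}
    {G : SimpleGraph V} {n : ℕ} (h : ArisesFromBall conv G n) : ArisesFromSphere conv G n := by
  obtain ⟨T, hT, hN, c, hc, ha, hG⟩ := h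
  exact ⟨hT.double, hT.isSymmetricSphereTriangulation_double, hT.noAntipodalVertices_double hN,
    hT.doubleColouring c, hT.isProperColouring_double ha hc, hT.isAntisymmetricColouring_double ha,
    hT.obtainedByAntipodalIdentification_double ha hG⟩

/-! ### Lifting from contractible spaces, and the covering of projective space -/

section Lifting

variable {E X A : Type*} [TopologicalSpace E] [TopologicalSpace X] [TopologicalSpace A]

/-- A map from a contractible space lifts through any surjective covering map. -/
theorem IsCoveringMap.exists_lift_of_contractibleSpace [ContractibleSpace A] {p : E → X}
    (hp : IsCoveringMap p) (hs : Function.Surjective p) (f : C(A, X)) :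
    ∃ g : C(A, E), ∀ a, p (g a) = f a := by
  obtain ⟨a₀, ⟨H⟩⟩ := id_nullhomotopic A
  obtain ⟨e, he⟩ := hs (f a₀)
  -- The reversed contraction runs from a constant map to the identity. Its start lifts to the
  -- constant `e`, and the end of the lifted homotopy is the required lift.
  let F := H.symm
  let L := hp.liftHomotopy (f.comp F.toContinuousMap) (ContinuousMap.const A e) (fun a => by
    simp [F, he])
  refine ⟨L.comp ((ContinuousMap.const A (1 : unitInterval)).prodMk (ContinuousMap.id A)), fun a => ?_⟩
  have := congrFun (hp.liftHomotopy_lifts (f.comp F.toContinuousMap) (ContinuousMap.const A e)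
    (fun a => by simp [F, he])) (1, a)
  refine this.trans ?_
  simp [F]

end Lifting

/-- The covering of the projective space by the sphere. -/
def toProjSpace {n : ℕ} (x : Metric.sphere (0 : EuclideanSpace ℝ (Fin (n + 1))) 1) :
    RealProjSpace n := Quotient.mk _ x

section toProjSpace

variable {n : ℕ}

theorem continuous_toProjSpace : Continuous (toProjSpace (n := n)) := continuous_quotient_mk'

theorem toProjSpace_surjective : Function.Surjective (toProjSpace (n := n)) :=
  Quotient.mk_surjective

theorem toProjSpace_eq_iff {x y : Metric.sphere (0 : EuclideanSpace ℝ (Fin (n + 1))) 1} :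
    toProjSpace x = toProjSpace y ↔ x = y ∨ x = -y :=
  Quotient.eq (r := antipodalSetoid n)

theorem toProjSpace_neg (x : Metric.sphere (0 : EuclideanSpace ℝ (Fin (n + 1))) 1) :
    toProjSpace (-x) = toProjSpace x := toProjSpace_eq_iff.2 (Or.inr rfl)

theorem ne_neg_of_sphere (x : Metric.sphere (0 : EuclideanSpace ℝ (Fin (n + 1))) 1) : x ≠ -x :=
  ne_neg_of_mem_unit_sphere ℝ x

theorem isOpenMap_toProjSpace : IsOpenMap (toProjSpace (n := n)) := by
  intro U hU
  refine isOpen_coinduced.2 ?_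
  have : (Quotient.mk (antipodalSetoid n)) ⁻¹' (toProjSpace '' U) = U ∪ Neg.neg ⁻¹' U := by
    ext x
    constructor
    · rintro ⟨y, hy, hyx⟩
      rcases toProjSpace_eq_iff.1 hyx with rfl | rfl
      exacts [Or.inl hy, Or.inr hy]
    · rintro (h | h)
      exacts [⟨x, h, rfl⟩, ⟨-x, h, toProjSpace_neg x⟩]
  refine (congrArg IsOpen this).mpr ?_
  exact hU.union (hU.preimage continuous_neg)

/-- The sphere is compact and the projective space is Hausdorff, so a local homeomorphism is enough.
The map is open, and it is injective on balls of radius `1`, since antipodal points have distance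
`2`. -/
theorem isCoveringMap_toProjSpace : IsCoveringMap (toProjSpace (n := n)) := by
  rw [← isLocalHomeomorph_iff_isCoveringMap, isLocalHomeomorph_iff_isOpenEmbedding_restrict]
  intro x
  have ho : IsOpen {y : Metric.sphere (0 : EuclideanSpace ℝ (Fin (n + 1))) 1 | dist y x < 1} :=
    isOpen_lt (by fun_prop) continuous_const
  refine ⟨_, ho.mem_nhds (by simp), ?_⟩
  refine IsOpenEmbedding.of_continuous_injective_isOpenMap
    (continuous_toProjSpace.comp continuous_subtype_val) ?_ (isOpenMap_toProjSpace.domRestrict ho)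
  rintro ⟨y, hy⟩ ⟨z, hz⟩ hyz
  rcases toProjSpace_eq_iff.1 hyz with h | rfl
  · exact Subtype.ext h
  · exfalso
    have h1 : dist (-z) z < 2 := by
      have := dist_triangle_right (-z) z x
      simp only [mem_ofPred_eq] at hy hz
      linarith
    have h2 : ‖(z : EuclideanSpace ℝ (Fin (n + 1)))‖ = 1 := by simp
    rw [Subtype.dist_eq, dist_eq_norm, coe_neg_sphere, ← neg_add', norm_neg, ← two_smul ℝ,
      norm_smul, h2] at h1
    norm_num at h1

end toProjSpace

/-! ### Local colourings of a quadrangulation and their double cover -/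

namespace GenSimplicialComplex

variable {X : Type*} [TopologicalSpace X] {K : GenSimplicialComplex X}

/-- The vertex `v` belongs to every closed cell that contains `x`, that is, to the smallest one. -/
def IsVertexNear (v : K.vertices) (x : X) : Prop :=
  ∀ t, x ∈ K.closedCell t → (v : X) ∈ K.closedCell t

/-- The smallest closed cell containing `x` has an edge in `F` that joins `v` and `w`. -/
def JoinedNear (F : Set K.Edge) (x : X) (v w : K.vertices) : Prop :=
  ∃ e ∈ F, (∀ t, x ∈ K.closedCell t → K.closedCell e.1 ⊆ K.closedCell t) ∧ K.Joins e v w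

/-- A choice, for each point `y` of a space `Y` over the complex, of a `2`-colouring of the vertices
of the smallest cell containing `f y` in which the bichromatic edges are those in `F`, such that
the choice is locally constant. -/
def IsColouringSystem (F : Set K.Edge) {Y : Type*} [TopologicalSpace Y] (f : Y → X)
    (τ : Y → K.vertices → Bool) : Prop :=
  (∀ y v w, IsVertexNear v (f y) → IsVertexNear w (f y) →
    (JoinedNear F (f y) v w ↔ τ y v ≠ τ y w)) ∧
  ∀ y v, IsVertexNear v (f y) → ∀ᶠ y' in 𝓝 y, τ y' v = τ y v

theorem isVertexNear_self (v : K.vertices) : IsVertexNear v v.1 := fun _ h => h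

variable {F : Set K.Edge}

section ColouringSystem

variable {Y : Type*} [TopologicalSpace Y] {f : Y → X} {τ τ₁ τ₂ : Y → K.vertices → Bool}

theorem IsColouringSystem.comp (h : IsColouringSystem F f τ) {Z : Type*} [TopologicalSpace Z]
    {g : Z → Y} (hg : Continuous g) : IsColouringSystem F (f ∘ g) (τ ∘ g) :=
  ⟨fun z => h.1 (g z), fun z v hv => hg.continuousAt.eventually (h.2 (g z) v hv)⟩

variable [T2Space X]

theorem exists_isVertexNear {x : X} (hx : x ∈ K.polyhedron) :
    ∃ v : K.vertices, IsVertexNear v x := by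
  obtain ⟨s, hs⟩ := mem_polyhedron.1 hx
  obtain ⟨r, hr⟩ := exists_openCell_of_mem_closedCell hs
  obtain ⟨v, hv⟩ := exists_vertex_mem r
  exact ⟨v, fun t ht => closedCell_subset_of_mem ht hr hv⟩

theorem isVertexNear_of_mem_openCell {r : K.Cell} {x : X} (hx : x ∈ K.openCell r) {v : K.vertices}
    (hv : (v : X) ∈ K.closedCell r) : IsVertexNear v x :=
  fun _ ht => closedCell_subset_of_mem ht hx hv

/-- The finitely many closed cells that miss `x` also miss a neighbourhood of it. So smallest cells
can only grow near `x`, and vertices near `x` stay near. -/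
theorem eventually_mem_closedCell_imp (x : X) :
    ∀ᶠ y in 𝓝 x, ∀ t, y ∈ K.closedCell t → x ∈ K.closedCell t := by
  have := K.finite_cell
  rw [eventually_all]
  intro t
  by_cases hx : x ∈ K.closedCell t
  · exact Eventually.of_forall fun _ _ => hx
  · filter_upwards [(isClosed_closedCell t).isOpen_compl.mem_nhds hx] with y hy h
    exact absurd h hy

theorem IsVertexNear.eventually {v : K.vertices} {x : X} (h : IsVertexNear v x) :
    ∀ᶠ y in 𝓝 x, IsVertexNear v y := by
  filter_upwards [eventually_mem_closedCell_imp (K := K) x] with y hy t ht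
  exact h t (hy t ht)

/-- The smallest cell at `y` contains the one at `x`, and a cell has only one edge between two given
vertices. Off the polyhedron the conditions on cells containing `y` would be vacuous. -/
theorem eventually_joinedNear_iff {x : X} (hx : x ∈ K.polyhedron) {v w : K.vertices}
    (hv : IsVertexNear v x) (hw : IsVertexNear w x) :
    ∀ᶠ y in 𝓝 x, y ∈ K.polyhedron → (JoinedNear F y v w ↔ JoinedNear F x v w) := by
  filter_upwards [eventually_mem_closedCell_imp (K := K) x] with y hy hyp
  constructor
  · rintro ⟨e, he, het, hj⟩
    refine ⟨e, he, fun t ht => ?_, hj⟩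
    obtain ⟨s, hs⟩ := mem_polyhedron.1 hx
    obtain ⟨r, hr⟩ := exists_openCell_of_mem_closedCell hs
    have hxr := openCell_subset_closedCell r hr
    obtain ⟨e', her, hj'⟩ := exists_edge hj.1 (hv r hxr) (hw r hxr)
    obtain ⟨s', hs'⟩ := mem_polyhedron.1 hyp
    obtain ⟨r', hr'⟩ := exists_openCell_of_mem_closedCell hs'
    have hyr' := openCell_subset_closedCell r' hr'
    have hrr' := closedCell_subset_of_mem (hy r' hyr') hr
    rw [hj.eq_of_subset hj' (het r' hyr') (her.trans hrr')]
    exact her.trans (closedCell_subset_of_mem ht hr)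
  · rintro ⟨e, he, het, hj⟩
    exact ⟨e, he, fun t ht => het t (hy t ht), hj⟩

/-- A quadrangulation is described on each cell by a `2`-colouring of the vertices. -/
theorem IsQuadrangulation.exists_colouring (hF : K.IsQuadrangulation F) {x : X}
    (hx : x ∈ K.polyhedron) : ∃ c : K.vertices → Bool, ∀ v w, IsVertexNear v x →
      IsVertexNear w x → (JoinedNear F x v w ↔ c v ≠ c w) := by
  classical
  obtain ⟨s, hs⟩ := mem_polyhedron.1 hx
  obtain ⟨r, hr⟩ := exists_openCell_of_mem_closedCell hs
  have hxr := openCell_subset_closedCell r hr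
  obtain ⟨m, hm, hrm⟩ := exists_isMaximalCell r
  obtain ⟨A, -, -, hA⟩ := hF m hm
  refine ⟨fun v => decide (∃ h : (v : X) ∈ K.closedCell m, (⟨v, h⟩ : {v : K.vertices //
    (v : X) ∈ K.closedCell m}) ∈ A), fun v w hv hw => ?_⟩
  have hvm := hv m (hrm hxr)
  have hwm := hw m (hrm hxr)
  have h := hA ⟨v, hvm⟩ ⟨w, hwm⟩
  have h' : (decide (∃ h : (v : X) ∈ K.closedCell m, (⟨v, h⟩ : {v : K.vertices //
      (v : X) ∈ K.closedCell m}) ∈ A) ≠ decide (∃ h : (w : X) ∈ K.closedCell m,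
      (⟨w, h⟩ : {v : K.vertices // (v : X) ∈ K.closedCell m}) ∈ A)) ↔
      ((⟨v, hvm⟩ : {v : K.vertices // (v : X) ∈ K.closedCell m}) ∈ A ↔
        (⟨w, hwm⟩ : {v : K.vertices // (v : X) ∈ K.closedCell m}) ∉ A) := by
    simp only [hvm, hwm, exists_true_left, ne_eq, decide_eq_decide]
    tauto
  rw [h', ← h]
  constructor
  · rintro ⟨e, he, het, hj⟩
    exact ⟨e, he, het m (hrm hxr), hj⟩
  · rintro ⟨e, he, hem, hj⟩
    refine ⟨e, he, fun t ht => ?_, hj⟩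
    -- By uniqueness, the edge of the maximal cell joining `v` and `w` is the one in the smallest
    -- cell.
    obtain ⟨e', her, hj'⟩ := exists_edge hj.1 (hv r hxr) (hw r hxr)
    rw [Joins.eq_of_subset hj hj' hem (her.trans hrm)]
    exact her.trans (closedCell_subset_of_mem ht hr)

/-- Two colouring systems differ at each point by a swap of colours or not at all, and locally
constantly so. -/
theorem IsColouringSystem.exists_isLocallyConstant (h₁ : IsColouringSystem F f τ₁)
    (h₂ : IsColouringSystem F f τ₂) (hf : Continuous f) (hfK : ∀ y, f y ∈ K.polyhedron) :
    ∃ κ : Y → Bool, IsLocallyConstant κ ∧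
      ∀ y v, IsVertexNear v (f y) → τ₁ y v = (κ y ^^ τ₂ y v) := by
  choose v hv using fun y => exists_isVertexNear (hfK y)
  have key : ∀ y w, IsVertexNear w (f y) →
      τ₁ y w = ((τ₁ y (v y) ^^ τ₂ y (v y)) ^^ τ₂ y w) := by
    intro y w hw
    have h := (h₁.1 y (v y) w (hv y) hw).symm.trans (h₂.1 y (v y) w (hv y) hw)
    revert h
    cases τ₁ y (v y) <;> cases τ₂ y (v y) <;> cases τ₁ y w <;> cases τ₂ y w <;> simp
  refine ⟨fun y => τ₁ y (v y) ^^ τ₂ y (v y), ?_, key⟩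
  rw [IsLocallyConstant.iff_eventually_eq]
  intro y
  -- The vertex chosen at `y` is still near `y'`, so the swap at `y'` can be computed with it, and
  -- there both colourings have the values they had at `y`.
  filter_upwards [h₁.2 y (v y) (hv y), h₂.2 y (v y) (hv y),
    hf.continuousAt.eventually (hv y).eventually] with y' h1 h2 h3
  have h := key y' (v y) h3
  rw [h1, h2] at h
  revert h
  cases τ₁ y (v y) <;> cases τ₂ y (v y) <;> cases τ₁ y' (v y') <;> cases τ₂ y' (v y') <;> simp

theorem IsColouringSystem.exists_eq_xor [PreconnectedSpace Y] (h₁ : IsColouringSystem F f τ₁)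
    (h₂ : IsColouringSystem F f τ₂) (hf : Continuous f) (hfK : ∀ y, f y ∈ K.polyhedron) :
    ∃ k : Bool, ∀ y v, IsVertexNear v (f y) → τ₁ y v = (k ^^ τ₂ y v) := by
  obtain ⟨κ, hκ, h⟩ := h₁.exists_isLocallyConstant h₂ hf hfK
  rcases isEmpty_or_nonempty Y with hY | ⟨⟨y₀⟩⟩
  · exact ⟨false, fun y => isEmptyElim y⟩
  · exact ⟨κ y₀, fun y v hv => by
      rw [h y v hv, hκ.apply_eq_of_preconnectedSpace y y₀]⟩

end ColouringSystem

section Bundle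

variable [T2Space X]

open Classical in
/-- The double cover of the polyhedron whose fibre over a point is the set of the `2`-colourings
of the smallest cell containing it that are compatible with the quadrangulation `F`. -/
noncomputable def colouringBundle (hF : K.IsQuadrangulation F) :
    FiberBundleCore K.vertices K.polyhedron Bool where
  baseSet v := {x | IsVertexNear v x.1}
  isOpen_baseSet v := by
    rw [isOpen_iff_mem_nhds]
    intro x hx
    exact continuous_subtype_val.continuousAt.eventually (IsVertexNear.eventually hx)
  indexAt x := (exists_isVertexNear x.2).choose
  mem_baseSet_at x := (exists_isVertexNear x.2).choose_spec
  -- The coordinate in the chart of `v` is the colour of `v`; the colour of `w` differs from it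
  -- exactly when `F` joins the two.
  coordChange v w x b := b ^^ decide (JoinedNear F x.1 v w)
  coordChange_self v x hx b := by
    have : ¬ JoinedNear F x.1 v v := by
      rintro ⟨_, _, _, h⟩
      exact h.1 rfl
    simp [this]
  continuousOn_coordChange v w := by
    rintro ⟨x, b⟩ ⟨hx, -⟩
    refine ContinuousAt.continuousWithinAt ?_
    have hc : ContinuousAt (fun p : K.polyhedron × Bool =>
        p.2 ^^ decide (JoinedNear F x.1 v w)) (x, b) :=
      (continuous_of_discreteTopology (f := fun b : Bool =>
        b ^^ decide (JoinedNear F x.1 v w))).continuousAt.comp continuousAt_snd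
    refine hc.congr ?_
    have hp : ContinuousAt (fun p : K.polyhedron × Bool => p.1.1) (x, b) := by fun_prop
    filter_upwards [hp.eventually (eventually_joinedNear_iff (F := F) x.2 hx.1 hx.2)] with p h
    simp only [h p.1.2]
  coordChange_comp u v w x hx b := by
    -- A local 2-colouring turns the transition functions into coboundaries, which gives the cocycle
    -- identity.
    obtain ⟨c, hc⟩ := hF.exists_colouring x.2
    simp only [hc u v hx.1.1 hx.1.2, hc v w hx.1.2 hx.2, hc u w hx.1.1 hx.2]
    cases c u <;> cases c v <;> cases c w <;> simp

/-- Colouring systems exist over contractible spaces. -/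
theorem IsQuadrangulation.exists_isColouringSystem (hF : K.IsQuadrangulation F) {A : Type*}
    [TopologicalSpace A] [ContractibleSpace A] (f : C(A, K.polyhedron)) :
    ∃ τ, IsColouringSystem F (fun a => (f a).1) τ := by
  classical
  let Z := colouringBundle hF
  have hcov : IsCoveringMap (Bundle.TotalSpace.proj (F := Bool) (E := Z.Fiber)) :=
    FiberBundle.isCoveringMap
  obtain ⟨g, hg⟩ := hcov.exists_lift_of_contractibleSpace (fun x => ⟨⟨x, false⟩, rfl⟩) f
  have happ : ∀ v a, (Z.localTriv v (g a)).2 =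
      (((g a).2 : Bool) ^^ decide (JoinedNear F (f a).1 (Z.indexAt (f a)) v)) := by
    intro v a
    rw [← hg a]
    rfl
  have key : ∀ b i p q : Bool, p ≠ q ↔ (b ^^ decide (i ≠ p)) ≠ (b ^^ decide (i ≠ q)) := by decide
  -- The colour of `v` at `a` is the coordinate of the lifted point `g a` in the chart of `v`; local
  -- constancy is continuity of that chart.
  refine ⟨fun a v => (Z.localTriv v (g a)).2, fun a v w hv hw => ?_, fun a v hv => ?_⟩
  · obtain ⟨c, hc⟩ := hF.exists_colouring (f a).2
    have hi : IsVertexNear (Z.indexAt (f a)) (f a).1 := Z.mem_baseSet_at (f a)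
    dsimp only
    rw [hc v w hv hw, happ, happ]
    simp only [hc _ v hi hv, hc _ w hi hw]
    exact key (g a).2 _ _ _
  · have hsrc : g a ∈ (Z.localTriv v).source := by
      rw [(Z.localTriv v).mem_source, show Z.proj (g a) = f a from hg a]
      exact hv
    have hcont : ContinuousAt (fun a => (Z.localTriv v (g a)).2) a :=
      continuousAt_snd.comp (((Z.localTriv v).continuousAt hsrc).comp g.continuous.continuousAt)
    exact hcont.eventually (mem_nhds_discrete.2 rfl : {b | b = _} ∈ _)

end Bundle

end GenSimplicialComplex

/-! ### The lift of a triangulation to the sphere -/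

/-- The unit sphere `S^n`. -/
abbrev UnitSphere (n : ℕ) : Type := Metric.sphere (0 : EuclideanSpace ℝ (Fin (n + 1))) 1

/-- A two-fold covering by the sphere whose fibres are the pairs of antipodal points. -/
structure IsAntipodalCovering {n : ℕ} {Y : Type*} [TopologicalSpace Y]
    (h : UnitSphere n → Y) : Prop where
  isCoveringMap : IsCoveringMap h
  surjective : Function.Surjective h
  eq_iff : ∀ x y, h x = h y ↔ x = y ∨ x = -y

theorem isAntipodalCovering_of_homeomorph {n : ℕ} {Y : Type*} [TopologicalSpace Y]
    (φ : RealProjSpace n ≃ₜ Y) : IsAntipodalCovering (φ ∘ toProjSpace) where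
  isCoveringMap := isCoveringMap_toProjSpace.homeomorph_comp φ
  surjective := φ.surjective.comp toProjSpace_surjective
  eq_iff _ _ := φ.injective.eq_iff.trans toProjSpace_eq_iff

instance {d : ℕ} : ContractibleSpace (stdSimplex ℝ (Fin (d + 1))) :=
  (convex_stdSimplex ℝ (Fin (d + 1))).contractibleSpace
    ⟨_, (stdSimplex.vertex 0 : stdSimplex ℝ (Fin (d + 1))).2⟩

namespace GenSimplicialComplex

variable {X : Type*} [TopologicalSpace X] {K : GenSimplicialComplex X} {n : ℕ}
  {h : UnitSphere n → K.polyhedron}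

/-- The lifts of the cells of the complex to the sphere. -/
structure LiftCell (K : GenSimplicialComplex X) (h : UnitSphere n → K.polyhedron) : Type where
  base : K.Cell
  lift : C(stdSimplex ℝ (Fin (K.dim base + 1)), UnitSphere n)
  map_lift : ∀ y, (h (lift y)).1 = K.char base y

namespace LiftCell

theorem eq_of_apply_eq {p : K.LiftCell h} {x y} (hxy : h (p.lift x) = h (p.lift y)) : x = y :=
  K.injective_char p.base (by rw [← p.map_lift x, ← p.map_lift y, hxy])

/-- If the closed cell `t` lies in `s`, then each lift of `s` restricts to a lift of `t`. -/
theorem exists_restrict [T2Space X] (p : K.LiftCell h) {t : K.Cell}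
    (hts : K.closedCell t ⊆ K.closedCell p.base) :
    ∃ (θ : stdSimplex ℝ (Fin (K.dim t + 1)) → stdSimplex ℝ (Fin (K.dim p.base + 1)))
      (g : C(stdSimplex ℝ (Fin (K.dim t + 1)), UnitSphere n)),
      (∀ y, (h (g y)).1 = K.char t y) ∧ (∀ y, K.char p.base (θ y) = K.char t y) ∧
      ∀ y, g y = p.lift (θ y) := by
  choose θ hθ using fun y => hts (mem_range_self y : K.char t y ∈ K.closedCell t)
  -- The simplex is compact and `X` is Hausdorff, so the characteristic map is an embedding, and the
  -- pointwise chosen `θ` is continuous.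
  have hemb : IsEmbedding (K.char p.base) :=
    ((K.continuous_char p.base).isClosedEmbedding (K.injective_char p.base)).isEmbedding
  have hc : Continuous θ := by
    rw [hemb.continuous_iff]
    exact (K.continuous_char t).congr fun y => (hθ y).symm
  exact ⟨θ, p.lift.comp ⟨θ, hc⟩, fun y => (p.map_lift (θ y)).trans (hθ y), hθ, fun _ => rfl⟩

end LiftCell

end GenSimplicialComplex

namespace IsAntipodalCovering

open GenSimplicialComplex

variable {X : Type*} [TopologicalSpace X] {K : GenSimplicialComplex X} {n : ℕ}
  {h : UnitSphere n → K.polyhedron} (hh : IsAntipodalCovering h)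

include hh

theorem continuous : Continuous h := hh.isCoveringMap.continuous

theorem map_neg (z : UnitSphere n) : h (-z) = h z := (hh.eq_iff _ _).2 (Or.inr rfl)

theorem val_eq_iff (x y : UnitSphere n) : (h x).1 = (h y).1 ↔ x = y ∨ x = -y := by
  rw [← hh.eq_iff, Subtype.ext_iff]

/-- Each cell has a lift through a given point. -/
theorem exists_liftCell (s : K.Cell) (y : stdSimplex ℝ (Fin (K.dim s + 1))) (z : UnitSphere n)
    (hz : (h z).1 = K.char s y) :
    ∃ f : C(stdSimplex ℝ (Fin (K.dim s + 1)), UnitSphere n),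
      (∀ y, (h (f y)).1 = K.char s y) ∧ f y = z := by
  obtain ⟨f, hf⟩ := hh.isCoveringMap.exists_lift_of_contractibleSpace hh.surjective
    (⟨fun y => ⟨K.char s y, closedCell_subset_polyhedron s (mem_range_self y)⟩,
      (K.continuous_char s).subtype_mk _⟩ : C(stdSimplex ℝ (Fin (K.dim s + 1)), K.polyhedron))
  have hf' : ∀ y, (h (f y)).1 = K.char s y := fun y => by rw [hf]; rfl
  -- Some lift exists; it passes through `z` or through `-z`, and in the second case its antipode is
  -- taken.
  rcases (hh.val_eq_iff (f y) z).1 (by rw [hf', hz]) with h' | h'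
  · exact ⟨f, hf', h'⟩
  · exact ⟨⟨fun y => -f y, continuous_neg.comp f.continuous⟩,
      fun y => by rw [← hf' y, ← hh.map_neg (f y)]; rfl, by
        rw [ContinuousMap.coe_mk, h', neg_neg]⟩

/-- Two lifts of the same cell that agree at a point are equal. -/
theorem lift_ext {s : K.Cell} {f g : C(stdSimplex ℝ (Fin (K.dim s + 1)), UnitSphere n)}
    (hf : ∀ y, (h (f y)).1 = K.char s y) (hg : ∀ y, (h (g y)).1 = K.char s y)
    {y : stdSimplex ℝ (Fin (K.dim s + 1))} (hy : f y = g y) : f = g := by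
  refine DFunLike.coe_injective (hh.isCoveringMap.eq_of_comp_eq f.continuous g.continuous ?_ y hy)
  funext x
  exact Subtype.ext ((hf x).trans (hg x).symm)

/-- Both parameters have the same image in the complex, hence coincide, and lifts through a common
point are unique. -/
theorem liftCell_ext {p q : K.LiftCell h} (hs : p.base = q.base) {x y} (hxy : p.lift x = q.lift y) :
    p = q := by
  obtain ⟨s, f, hf⟩ := p
  obtain ⟨t, g, hg⟩ := q
  obtain rfl : s = t := hs
  have : x = y := K.injective_char s (by rw [← hf x, ← hg y]; exact congrArg (fun z => (h z).1) hxy)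
  subst this
  obtain rfl := hh.lift_ext hf hg hxy
  rfl

/-- The antipodal lift of a cell. -/
noncomputable def negLift (p : K.LiftCell h) : K.LiftCell h :=
  ⟨p.base, ⟨fun y => -p.lift y, continuous_neg.comp p.lift.continuous⟩, fun y =>
    (congrArg Subtype.val (hh.map_neg (p.lift y))).trans (p.map_lift y)⟩

theorem eq_or_eq_negLift {p q : K.LiftCell h} (hs : p.base = q.base) : p = q ∨ p = hh.negLift q := by
  have y : stdSimplex ℝ (Fin (K.dim p.base + 1)) := stdSimplex.vertex 0
  have hy : K.char p.base y ∈ K.closedCell q.base := hs ▸ mem_range_self y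
  obtain ⟨y', hy'⟩ := hy
  rcases (hh.val_eq_iff (p.lift y) (q.lift y')).1 (by rw [p.map_lift, q.map_lift, hy']) with h' | h'
  · exact Or.inl (hh.liftCell_ext hs h')
  · exact Or.inr (hh.liftCell_ext (q := hh.negLift q) hs h')

theorem finite_liftCell : Finite (K.LiftCell h) := by
  have := K.finite_cell
  have hex : ∀ s : K.Cell, ∃ p : K.LiftCell h, p.base = s := by
    intro s
    obtain ⟨z, hz⟩ := hh.surjective ⟨K.char s (stdSimplex.vertex 0),
      closedCell_subset_polyhedron s (mem_range_self _)⟩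
    obtain ⟨f, hf, -⟩ := hh.exists_liftCell s (stdSimplex.vertex 0) z (by rw [hz])
    exact ⟨⟨s, f, hf⟩, rfl⟩
  choose L hL using hex
  refine Finite.of_surjective (fun q : K.Cell × Bool => if q.2 then L q.1 else hh.negLift (L q.1))
    fun p => ?_
  rcases hh.eq_or_eq_negLift (hL p.base).symm with h' | h'
  · exact ⟨(p.base, true), h'.symm⟩
  · exact ⟨(p.base, false), h'.symm⟩

variable [T2Space X]

/-- The lift of a triangulation to the sphere. -/
noncomputable def liftComplex : GenSimplicialComplex (EuclideanSpace ℝ (Fin (n + 1))) where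
  Cell := K.LiftCell h
  finite_cell := hh.finite_liftCell
  dim p := K.dim p.base
  char p y := (p.lift y).1
  continuous_char p := continuous_subtype_val.comp p.lift.continuous
  injective_char p x y hxy := LiftCell.eq_of_apply_eq (congrArg h (Subtype.ext hxy))
  exists_face p S hS := by
    obtain ⟨t, hd, ht⟩ := K.exists_face p.base S hS
    have hts : K.closedCell t ⊆ K.closedCell p.base := by
      obtain ⟨x, hx⟩ := openCell_nonempty t
      refine closedCell_subset_of_mem ?_ hx
      rw [openCell, ht] at hx
      exact image_subset_range _ _ hx
    -- The face required is the restriction of the lift `p` to `t`; `θ` carries the open simplex of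
    -- `t` onto the open face `S`.
    obtain ⟨θ, g, hg, hθ, hgθ⟩ := p.exists_restrict hts
    refine ⟨⟨t, g, hg⟩, hd, ?_⟩
    ext z
    constructor
    · rintro ⟨y, hy, rfl⟩
      refine ⟨θ y, ?_, congrArg Subtype.val (hgθ y).symm⟩
      have : K.char t y ∈ K.char p.base '' simplexOpenFace S := ht ▸ mem_image_of_mem _ hy
      rw [← hθ] at this
      exact (K.injective_char _).mem_set_image.1 this
    · rintro ⟨x, hx, rfl⟩
      have : K.char p.base x ∈ K.char t '' simplexOpenFace Finset.univ :=
        ht ▸ mem_image_of_mem _ hx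
      obtain ⟨y, hy, hyx⟩ := this
      rw [← hθ] at hyx
      refine ⟨y, hy, ?_⟩
      exact congrArg Subtype.val ((hgθ y).trans (by rw [K.injective_char _ hyx]))
  disjoint_openCell p q hpq := by
    rw [disjoint_left]
    rintro _ ⟨x, hx, rfl⟩ ⟨y, hy, hxy⟩
    have hxy' : q.lift y = p.lift x := Subtype.ext hxy
    refine hpq (hh.liftCell_ext ?_ hxy'.symm)
    refine eq_of_mem_openCell (mem_image_of_mem _ hx : K.char p.base x ∈ K.openCell p.base) ?_
    rw [← p.map_lift, ← hxy', q.map_lift]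
    exact mem_image_of_mem _ hy

/-- The cell of the complex of which a cell is the lift. -/
noncomputable def below (p : hh.liftComplex.Cell) : K.Cell := LiftCell.base p

theorem mem_closedCell_liftComplex {p : hh.liftComplex.Cell} {z : UnitSphere n} :
    z.1 ∈ hh.liftComplex.closedCell p ↔ ∃ y, LiftCell.lift p y = z :=
  exists_congr fun _ => Subtype.ext_iff.symm

theorem exists_of_mem_closedCell {p : hh.liftComplex.Cell} {z : EuclideanSpace ℝ (Fin (n + 1))}
    (hz : z ∈ hh.liftComplex.closedCell p) : ∃ y, z = (LiftCell.lift p y).1 :=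
  hz.imp fun _ h' => h'.symm

theorem map_mem_closedCell {p : hh.liftComplex.Cell} {z : UnitSphere n}
    (hz : z.1 ∈ hh.liftComplex.closedCell p) : (h z).1 ∈ K.closedCell (hh.below p) := by
  obtain ⟨y, rfl⟩ := hh.mem_closedCell_liftComplex.1 hz
  exact ⟨y, (p.map_lift y).symm⟩

theorem exists_cell_of_map_mem {s : K.Cell} {z : UnitSphere n} (hz : (h z).1 ∈ K.closedCell s) :
    ∃ p : hh.liftComplex.Cell, hh.below p = s ∧ z.1 ∈ hh.liftComplex.closedCell p := by
  obtain ⟨y, hy⟩ := hz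
  obtain ⟨f, hf, hfy⟩ := hh.exists_liftCell s y z hy.symm
  exact ⟨⟨s, f, hf⟩, rfl, hh.mem_closedCell_liftComplex.2 ⟨y, hfy⟩⟩

theorem exists_mem_of_mem_below {p : hh.liftComplex.Cell} {x : X}
    (hx : x ∈ K.closedCell (hh.below p)) :
    ∃ z : UnitSphere n, z.1 ∈ hh.liftComplex.closedCell p ∧ (h z).1 = x := by
  obtain ⟨y, rfl⟩ := hx
  exact ⟨p.lift y, hh.mem_closedCell_liftComplex.2 ⟨y, rfl⟩, p.map_lift y⟩

theorem eq_of_map_eq {p : hh.liftComplex.Cell} {z w : UnitSphere n}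
    (hz : z.1 ∈ hh.liftComplex.closedCell p) (hw : w.1 ∈ hh.liftComplex.closedCell p)
    (hzw : h z = h w) : z = w := by
  obtain ⟨y, rfl⟩ := hh.mem_closedCell_liftComplex.1 hz
  obtain ⟨y', rfl⟩ := hh.mem_closedCell_liftComplex.1 hw
  rw [LiftCell.eq_of_apply_eq (p := p) hzw]

theorem closedCell_negLift (p : hh.liftComplex.Cell) :
    hh.liftComplex.closedCell (hh.negLift p) = -hh.liftComplex.closedCell p := by
  rw [← Set.image_neg_eq_neg]
  exact range_comp Neg.neg (hh.liftComplex.char p)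

theorem eq_or_closedCell_eq_neg {p q : hh.liftComplex.Cell} (hpq : hh.below p = hh.below q) :
    p = q ∨ hh.liftComplex.closedCell q = -hh.liftComplex.closedCell p := by
  rcases hh.eq_or_eq_negLift hpq with h' | h'
  · exact Or.inl h'
  · refine Or.inr ?_
    have := hh.closedCell_negLift q
    rw [← h'] at this
    rw [this, neg_neg]

theorem isSymmetricSphereTriangulation_liftComplex :
    hh.liftComplex.IsSymmetricSphereTriangulation := by
  refine ⟨subset_antisymm (fun z hz => ?_) fun z hz => ?_,
    fun p => ⟨hh.negLift p, hh.closedCell_negLift p⟩⟩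
  · obtain ⟨p, hp⟩ := mem_polyhedron.1 hz
    obtain ⟨y, rfl⟩ := hh.exists_of_mem_closedCell hp
    exact Subtype.prop _
  · obtain ⟨s, hs⟩ := mem_polyhedron.1 (h ⟨z, hz⟩).2
    obtain ⟨p, -, hp⟩ := hh.exists_cell_of_map_mem hs
    exact mem_polyhedron.2 ⟨p, hp⟩

/-- Antipodal points have the same image under `h`, while `h` is injective on each lifted cell. -/
theorem noAntipodalVertices_liftComplex : hh.liftComplex.NoAntipodalVertices := by
  intro p u v hu hvu hup hvp
  let z : UnitSphere n := ⟨u, by simpa using hu⟩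
  have hz : v.1 = (-z).1 := hvu
  rw [hz] at hvp
  exact ne_neg_of_sphere z (hh.eq_of_map_eq hup hvp (hh.map_neg z).symm)

theorem mem_vertices_liftComplex {z : UnitSphere n} :
    z.1 ∈ hh.liftComplex.vertices ↔ (h z).1 ∈ K.vertices := by
  constructor
  · rintro ⟨p, hd, hp⟩
    exact ⟨hh.below p, hd, hh.map_mem_closedCell hp⟩
  · rintro ⟨s, hd, hs⟩
    obtain ⟨p, rfl, hp⟩ := hh.exists_cell_of_map_mem hs
    exact ⟨p, hd, hp⟩

/-- A vertex of the lifted triangulation as a point of the sphere. -/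
noncomputable def spherePoint (u : hh.liftComplex.vertices) : UnitSphere n :=
  ⟨u.1, by
    simpa using hh.isSymmetricSphereTriangulation_liftComplex.norm_vertex u⟩

/-- The vertex below a vertex of the lifted triangulation. -/
noncomputable def vertexBelow (u : hh.liftComplex.vertices) : K.vertices :=
  ⟨h (hh.spherePoint u), hh.mem_vertices_liftComplex.1 u.2⟩

theorem vertexBelow_eq_iff {u v : hh.liftComplex.vertices} :
    hh.vertexBelow u = hh.vertexBelow v ↔ u = v ∨ v.1 = -u.1 := by
  rw [Subtype.ext_iff]
  refine (hh.val_eq_iff _ _).trans (or_congr ?_ ?_)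
  · rw [Subtype.ext_iff, Subtype.ext_iff]
    rfl
  · rw [eq_comm, neg_eq_iff_eq_neg, Subtype.ext_iff]
    rfl

theorem vertexBelow_mem {p : hh.liftComplex.Cell} {u : hh.liftComplex.vertices}
    (hu : u.1 ∈ hh.liftComplex.closedCell p) : (hh.vertexBelow u).1 ∈ K.closedCell (hh.below p) :=
  hh.map_mem_closedCell (z := hh.spherePoint u) hu

theorem exists_vertexBelow_eq {p : hh.liftComplex.Cell} {v : K.vertices}
    (hv : v.1 ∈ K.closedCell (hh.below p)) :
    ∃ u : hh.liftComplex.vertices, u.1 ∈ hh.liftComplex.closedCell p ∧ hh.vertexBelow u = v := by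
  obtain ⟨z, hz, hzv⟩ := hh.exists_mem_of_mem_below hv
  exact ⟨⟨z.1, hh.mem_vertices_liftComplex.2 (by rw [hzv]; exact v.2)⟩, hz, Subtype.ext hzv⟩

theorem vertexBelow_surjective : Function.Surjective hh.vertexBelow := by
  intro v
  obtain ⟨s, -, hs⟩ := v.2
  obtain ⟨z, hz⟩ := hh.surjective ⟨v, closedCell_subset_polyhedron s hs⟩
  refine ⟨⟨z.1, hh.mem_vertices_liftComplex.2 (by rw [hz]; exact v.2)⟩, Subtype.ext ?_⟩
  exact congrArg (fun x : K.polyhedron => x.1) hz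

/-- The edge below an edge of the lifted triangulation. -/
noncomputable def edgeBelow (e : hh.liftComplex.Edge) : K.Edge := ⟨hh.below e.1, e.2⟩

theorem joins_edgeBelow {e : hh.liftComplex.Edge} {u v : hh.liftComplex.vertices}
    (he : hh.liftComplex.Joins e u v) :
    K.Joins (hh.edgeBelow e) (hh.vertexBelow u) (hh.vertexBelow v) := by
  refine ⟨fun huv => he.1 (Subtype.ext ?_), hh.vertexBelow_mem he.2.1, hh.vertexBelow_mem he.2.2⟩
  have := hh.eq_of_map_eq (z := hh.spherePoint u) (w := hh.spherePoint v) he.2.1 he.2.2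
    (Subtype.ext (congrArg (fun x : K.vertices => x.1) huv))
  exact congrArg (fun z : UnitSphere n => z.1) this

theorem exists_joins_of_edge (e : K.Edge) {u : hh.liftComplex.vertices} {v : K.vertices}
    (he : K.Joins e (hh.vertexBelow u) v) : ∃ e' w, hh.edgeBelow e' = e ∧ hh.vertexBelow w = v ∧
      hh.liftComplex.Joins e' u w := by
  obtain ⟨p, hp, hup⟩ := hh.exists_cell_of_map_mem (z := hh.spherePoint u) he.2.1
  have hv : v.1 ∈ K.closedCell (hh.below p) := hp ▸ he.2.2
  obtain ⟨w, hw, rfl⟩ := hh.exists_vertexBelow_eq hv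
  refine ⟨⟨p, (congrArg K.dim hp).trans e.2⟩, w, Subtype.ext hp, rfl, ?_, hup, hw⟩
  rintro rfl
  exact he.1 rfl

theorem below_subset {p q : hh.liftComplex.Cell}
    (hpq : hh.liftComplex.closedCell p ⊆ hh.liftComplex.closedCell q) :
    K.closedCell (hh.below p) ⊆ K.closedCell (hh.below q) := by
  intro x hx
  obtain ⟨z, hz, rfl⟩ := hh.exists_mem_of_mem_below hx
  exact hh.map_mem_closedCell (hpq hz)

/-- If `t` contains the cell below `p`, lift `t` to a cell `q` through a point of `p`. Restricting
`q` to the cell below `p` gives a lift that meets `p`, hence equals `p`. So `p` lies in `q`, and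
maximality gives `q = p`. -/
theorem isMaximalCell_below {p : hh.liftComplex.Cell} (hp : hh.liftComplex.IsMaximalCell p) :
    K.IsMaximalCell (hh.below p) := by
  intro t ht
  let z := p.lift (stdSimplex.vertex 0)
  have hz : z.1 ∈ hh.liftComplex.closedCell p := hh.mem_closedCell_liftComplex.2 ⟨_, rfl⟩
  obtain ⟨q, rfl, hq⟩ := hh.exists_cell_of_map_mem (ht (hh.map_mem_closedCell hz))
  obtain ⟨θ, g, hg, hθ, hgθ⟩ := LiftCell.exists_restrict q ht
  let r : hh.liftComplex.Cell := LiftCell.mk _ g hg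
  have hrsub : hh.liftComplex.closedCell r ⊆ hh.liftComplex.closedCell q := by
    rintro _ ⟨y, rfl⟩
    exact hh.mem_closedCell_liftComplex.2 ⟨_, (hgθ y).symm⟩
  have hzr : z.1 ∈ hh.liftComplex.closedCell r := by
    have : (h z).1 ∈ K.closedCell (hh.below r) :=
      (hh.map_mem_closedCell hz : (h z).1 ∈ K.closedCell (hh.below p))
    obtain ⟨w, hw, hwz⟩ := hh.exists_mem_of_mem_below this
    rwa [← hh.eq_of_map_eq (hrsub hw) hq (Subtype.ext hwz)]
  obtain ⟨y, hy⟩ := hh.mem_closedCell_liftComplex.1 hzr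
  have hrp : r = p := hh.liftCell_ext (p := r) (q := p) rfl hy
  rw [hp q (hrp ▸ hrsub)]

end IsAntipodalCovering

/-! ### A colouring system on the whole sphere -/

section BallMaps

variable {n : ℕ}

/-- The map of the closed unit ball onto the upper hemisphere. -/
noncomputable def ballToSphere (x : Metric.closedBall (0 : EuclideanSpace ℝ (Fin n)) 1) :
    UnitSphere n :=
  ⟨hemisphere x, mem_sphere_zero_iff_norm.2 (norm_hemisphere (mem_closedBall_zero_iff.1 x.2))⟩

/-- The vertical projection of the sphere onto the closed unit ball. -/
noncomputable def sphereToBall (z : UnitSphere n) :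
    Metric.closedBall (0 : EuclideanSpace ℝ (Fin n)) 1 :=
  ⟨flatten z, mem_closedBall_zero_iff.2
    ((norm_flatten_le _).trans (mem_sphere_zero_iff_norm.1 z.2).le)⟩

theorem continuous_ballToSphere : Continuous (ballToSphere (n := n)) :=
  (continuous_hemisphere.comp continuous_subtype_val).subtype_mk _

theorem continuous_sphereToBall : Continuous (sphereToBall (n := n)) :=
  (continuous_flatten.comp continuous_subtype_val).subtype_mk _

theorem ballToSphere_sphereToBall {z : UnitSphere n} (hz : 0 ≤ z.1 0) :
    ballToSphere (sphereToBall z) = z :=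
  Subtype.ext (hemisphere_flatten (mem_sphere_zero_iff_norm.1 z.2) hz)

end BallMaps

namespace IsAntipodalCovering

open GenSimplicialComplex

variable {X : Type*} [TopologicalSpace X] [T2Space X] {K : GenSimplicialComplex X} {n : ℕ}
  {h : UnitSphere n → K.polyhedron} {F : Set K.Edge}

/-- A locally constant function on `S^(n-1)` that is invariant under the antipodal map is
constant. -/
theorem _root_.IsLocallyConstant.exists_eq_of_sphere
    {κ : Metric.sphere (0 : EuclideanSpace ℝ (Fin n)) 1 → Bool} (hκ : IsLocallyConstant κ)
    (hneg : ∀ y, κ (-y) = κ y) : ∃ k, ∀ y, κ y = k := by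
  rcases isEmpty_or_nonempty (Metric.sphere (0 : EuclideanSpace ℝ (Fin n)) 1) with hY | ⟨⟨y₀⟩⟩
  · exact ⟨false, fun y => isEmptyElim y⟩
  refine ⟨κ y₀, fun y => ?_⟩
  rcases Nat.lt_or_ge 1 n with hn | hn
  · have hpre : IsPreconnected (Metric.sphere (0 : EuclideanSpace ℝ (Fin n)) 1) := by
      refine isPreconnected_sphere ?_ 0 1
      rw [← Module.finrank_eq_rank, finrank_euclideanSpace_fin]
      exact_mod_cast hn
    have := isPreconnected_iff_preconnectedSpace.1 hpre
    exact hκ.apply_eq_of_preconnectedSpace y y₀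
  · have hy := mem_sphere_zero_iff_norm.1 y.2
    have hy₀ := mem_sphere_zero_iff_norm.1 y₀.2
    obtain rfl | rfl : n = 0 ∨ n = 1 := by omega
    · rw [Subsingleton.elim y y₀]
    -- `S^0` is disconnected, but it is a single antipodal pair, so invariance replaces
    -- connectedness.
    · rcases EuclideanSpace.eq_or_eq_neg_of_norm_eq_one hy hy₀ with h | h
      · rw [Subtype.ext h]
      · rw [show y = -y₀ from Subtype.ext h, hneg]

variable (hh : IsAntipodalCovering h)

include hh

/-- A system over the ball is a system over the upper hemisphere, and its antipodal copy serves the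
lower one because `h` identifies antipodes. On the equator they differ by a constant swap `k`, which
is undone on the lower side. -/
theorem exists_isColouringSystem (hF : K.IsQuadrangulation F) :
    ∃ τ, IsColouringSystem F (fun z => (h z).1) τ := by
  have : ContractibleSpace (Metric.closedBall (0 : EuclideanSpace ℝ (Fin n)) 1) :=
    (convex_closedBall _ _).contractibleSpace ⟨0, by simp⟩
  obtain ⟨τ, hτ⟩ := hF.exists_isColouringSystem
    (⟨fun x => h (ballToSphere x), hh.continuous.comp continuous_ballToSphere⟩ :
      C(Metric.closedBall (0 : EuclideanSpace ℝ (Fin n)) 1, K.polyhedron))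
  have hτ₁ : IsColouringSystem F (fun z => (h (ballToSphere (sphereToBall z))).1)
      (fun z => τ (sphereToBall z)) := hτ.comp continuous_sphereToBall
  have hτ₂ : IsColouringSystem F (fun z => (h (ballToSphere (sphereToBall (-z)))).1)
      (fun z => τ (sphereToBall (-z))) := hτ.comp (continuous_sphereToBall.comp continuous_neg)
  -- the two systems over the equator
  let ι : Metric.sphere (0 : EuclideanSpace ℝ (Fin n)) 1 →
      Metric.closedBall (0 : EuclideanSpace ℝ (Fin n)) 1 :=
    fun y => ⟨y.1, Metric.sphere_subset_closedBall y.2⟩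
  have hι : Continuous ι := continuous_subtype_val.subtype_mk _
  have hιneg : ∀ y, h (ballToSphere (ι (-y))) = h (ballToSphere (ι y)) := by
    intro y
    rw [← hh.map_neg]
    exact congrArg h (Subtype.ext
      (neg_eq_iff_eq_neg.2 (hemisphere_neg (mem_sphere_zero_iff_norm.1 y.2))))
  have hσ₁ : IsColouringSystem F (fun y => (h (ballToSphere (ι y))).1) (fun y => τ (ι y)) :=
    hτ.comp hι
  have hσ₂ : IsColouringSystem F (fun y => (h (ballToSphere (ι y))).1) (fun y => τ (ι (-y))) := by
    have : IsColouringSystem F (fun y => (h (ballToSphere (ι (-y)))).1) (fun y => τ (ι (-y))) :=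
      hτ.comp (hι.comp continuous_neg)
    simpa only [hιneg] using this
  obtain ⟨κ, hκ, hκτ⟩ := hσ₁.exists_isLocallyConstant hσ₂ (continuous_subtype_val.comp
    (hh.continuous.comp (continuous_ballToSphere.comp hι))) (fun y => (h _).2)
  -- Replacing `y` by `-y` exchanges the two systems being compared, so the swap is the same at both
  -- points.
  obtain ⟨k, hk⟩ := hκ.exists_eq_of_sphere (fun y => by
    obtain ⟨v, hv⟩ := exists_isVertexNear (h (ballToSphere (ι y))).2
    have h1 := hκτ y v hv
    have h2 := hκτ (-y) v (by rw [hιneg]; exact hv)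
    rw [neg_neg, h1] at h2
    revert h2
    cases κ y <;> cases κ (-y) <;> simp)
  have hequator : ∀ z : UnitSphere n, z.1 0 = 0 → ∀ v, IsVertexNear v (h z).1 →
      τ (sphereToBall z) v = (k ^^ τ (sphereToBall (-z)) v) := by
    intro z hz v hv
    have hn : ‖flatten z.1‖ = 1 := by
      have := norm_sq_eq_add_norm_flatten_sq z.1
      rw [mem_sphere_zero_iff_norm.1 z.2, hz] at this
      exact (pow_eq_one_iff_of_nonneg (norm_nonneg _) two_ne_zero).1 (by linarith)
    let y : Metric.sphere (0 : EuclideanSpace ℝ (Fin n)) 1 :=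
      ⟨flatten z.1, mem_sphere_zero_iff_norm.2 hn⟩
    have := hκτ y v (by
      rw [show ballToSphere (ι y) = z from ballToSphere_sphereToBall hz.ge]
      exact hv)
    rwa [hk] at this
  -- glue the two hemispheres
  let σ : UnitSphere n → K.vertices → Bool := fun z v =>
    if 0 ≤ z.1 0 then τ (sphereToBall z) v else k ^^ τ (sphereToBall (-z)) v
  have hlow : ∀ z : UnitSphere n, z.1 0 ≤ 0 →
      h (ballToSphere (sphereToBall (-z))) = h z := by
    intro z hz
    rw [ballToSphere_sphereToBall, hh.map_neg]
    have : (-z).1 0 = -z.1 0 := rfl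
    rw [this]
    linarith
  have hσhi : ∀ z : UnitSphere n, 0 ≤ z.1 0 → ∀ v, σ z v = τ (sphereToBall z) v :=
    fun z hz v => if_pos hz
  have hσlo : ∀ z : UnitSphere n, z.1 0 ≤ 0 → ∀ v, IsVertexNear v (h z).1 →
      σ z v = (k ^^ τ (sphereToBall (-z)) v) := by
    intro z hz v hv
    rcases hz.lt_or_eq with hz | hz
    · exact if_neg hz.not_ge
    · rw [hσhi z hz.ge, hequator z hz v hv]
  have hcz : Continuous fun z : UnitSphere n => z.1 0 := by fun_prop
  refine ⟨σ, fun z v w hv hw => ?_, fun z v hv => ?_⟩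
  · rcases le_total 0 (z.1 0) with hz | hz
    · rw [hσhi z hz, hσhi z hz]
      have := hτ₁.1 z v w
      simp only [ballToSphere_sphereToBall hz] at this
      exact this hv hw
    · rw [hσlo z hz v hv, hσlo z hz w hw]
      have := hτ₂.1 z v w
      simp only [hlow z hz] at this
      rw [this hv hw, ne_eq, ne_eq, Bool.xor_right_inj]
  · have hhi : 0 ≤ z.1 0 → ∀ᶠ z' in 𝓝 z, 0 ≤ z'.1 0 → σ z' v = σ z v := by
      intro hz
      have := hτ₁.2 z v (by
        simp only [ballToSphere_sphereToBall hz]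
        exact hv)
      filter_upwards [this] with z' h1 h2
      rw [hσhi z' h2, hσhi z hz, h1]
    have hlo : z.1 0 ≤ 0 → ∀ᶠ z' in 𝓝 z, z'.1 0 ≤ 0 → σ z' v = σ z v := by
      intro hz
      have := hτ₂.2 z v (by
        simp only [hlow z hz]
        exact hv)
      have hnear : ∀ᶠ z' in 𝓝 z, IsVertexNear v (h z').1 :=
        (continuous_subtype_val.comp hh.continuous).continuousAt.eventually hv.eventually
      filter_upwards [this, hnear] with z' h1 h3 h2
      rw [hσlo z' h2 v h3, hσlo z hz v hv, h1]
    -- Away from the equator one hemisphere is a neighbourhood; on the equator both one-sided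
    -- statements are combined.
    rcases lt_trichotomy (z.1 0) 0 with hz | hz | hz
    · filter_upwards [hlo hz.le, hcz.continuousAt.eventually (gt_mem_nhds hz)] with z' h1 h2
      exact h1 h2.le
    · filter_upwards [hlo hz.le, hhi hz.ge] with z' h1 h2
      exact (le_total (z'.1 0) 0).elim h1 h2
    · filter_upwards [hhi hz.le, hcz.continuousAt.eventually (lt_mem_nhds hz)] with z' h1 h2
      exact h1 h2.le

end IsAntipodalCovering

/-! ### The colouring of the lifted triangulation -/

theorem isPreconnected_simplexOpenFace_univ {d : ℕ} :
    IsPreconnected (simplexOpenFace (Finset.univ : Finset (Fin (d + 1)))) := by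
  rw [← IsInducing.subtypeVal.isPreconnected_image]
  have : Subtype.val '' simplexOpenFace (Finset.univ : Finset (Fin (d + 1))) =
      stdSimplex ℝ (Fin (d + 1)) ∩ {x | ∀ i, 0 < x i} := by
    ext x
    simp [simplexOpenFace, and_comm]
  rw [this]
  refine (Convex.inter (convex_stdSimplex ℝ _) ?_).isPreconnected
  simp only [ofPred_forall]
  exact convex_iInter fun i => convex_halfSpace_gt (IsLinearMap.mk (fun _ _ => rfl) fun _ _ => rfl) 0

namespace IsAntipodalCovering

open GenSimplicialComplex

variable {X : Type*} [TopologicalSpace X] [T2Space X] {K : GenSimplicialComplex X} {n : ℕ}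
  {h : UnitSphere n → K.polyhedron} {F : Set K.Edge} (hh : IsAntipodalCovering h)
  {τ : UnitSphere n → K.vertices → Bool}

/-- The colouring of the vertices of the lifted triangulation given by a colouring system. -/
noncomputable def liftColouring (τ : UnitSphere n → K.vertices → Bool)
    (u : hh.liftComplex.vertices) : Bool := τ (hh.spherePoint u) (hh.vertexBelow u)

include hh

theorem isVertexNear_vertexBelow (u : hh.liftComplex.vertices) :
    IsVertexNear (hh.vertexBelow u) (h (hh.spherePoint u)).1 :=
  isVertexNear_self (hh.vertexBelow u)

theorem map_lift_mem_openCell (p : hh.liftComplex.Cell)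
    {y : stdSimplex ℝ (Fin (K.dim (hh.below p) + 1))} (hy : y ∈ simplexOpenFace Finset.univ) :
    (h (LiftCell.lift p y)).1 ∈ K.openCell (hh.below p) :=
  ⟨y, hy, (LiftCell.map_lift p y).symm⟩

/-- Over an open simplex, a colouring system has the values that it has at the vertices. -/
theorem colouringSystem_eq_liftColouring (hτ : IsColouringSystem F (fun z => (h z).1) τ)
    (p : hh.liftComplex.Cell) {u : hh.liftComplex.vertices}
    (hu : u.1 ∈ hh.liftComplex.closedCell p) {y : stdSimplex ℝ (Fin (K.dim (hh.below p) + 1))}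
    (hy : y ∈ simplexOpenFace Finset.univ) :
    τ (LiftCell.lift p y) (hh.vertexBelow u) = hh.liftColouring τ u := by
  obtain ⟨a, ha⟩ := hh.mem_closedCell_liftComplex (z := hh.spherePoint u).1 hu
  have hnear : ∀ x ∈ simplexOpenFace Finset.univ,
      IsVertexNear (hh.vertexBelow u) (h (LiftCell.lift p x)).1 := by
    intro x hx
    exact isVertexNear_of_mem_openCell (hh.map_lift_mem_openCell p hx) (hh.vertexBelow_mem hu)
  have hcont : ContinuousOn (fun x => τ (LiftCell.lift p x) (hh.vertexBelow u))
      (simplexOpenFace Finset.univ) := by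
    intro x hx
    refine ContinuousAt.continuousWithinAt ?_
    refine continuousAt_const.congr (EventuallyEq.symm ?_) (f := fun _ =>
      τ (LiftCell.lift p x) (hh.vertexBelow u))
    exact (LiftCell.lift p).continuous.continuousAt.eventually (hτ.2 _ _ (hnear x hx))
  -- Local constancy at the vertex `u`, whose parameter is `a`, fixes the value near `a`. The open
  -- simplex accumulates at `a`, and the value is constant on it by connectedness.
  have hev : ∀ᶠ x in 𝓝 a, τ (LiftCell.lift p x) (hh.vertexBelow u) = hh.liftColouring τ u := by
    have h1 := hτ.2 _ _ (hh.isVertexNear_vertexBelow u)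
    rw [← ha] at h1
    have h2 := (LiftCell.lift p).continuous.continuousAt.eventually h1
    rw [ha] at h2
    exact h2
  have hcl : a ∈ closure (simplexOpenFace Finset.univ) := by
    rw [closure_simplexOpenFace_univ]
    exact mem_univ a
  obtain ⟨x, hx1, hx2⟩ := mem_closure_iff_nhds.1 hcl _ hev
  exact (isPreconnected_simplexOpenFace_univ.constant hcont hy hx2).trans hx1

/-- The bichromatic edges of the lifted triangulation are the lifts of the edges in `F`. -/
theorem liftColouring_ne_iff (hτ : IsColouringSystem F (fun z => (h z).1) τ)
    {e : hh.liftComplex.Edge} {u v : hh.liftComplex.vertices} (he : hh.liftComplex.Joins e u v) :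
    hh.liftColouring τ u ≠ hh.liftColouring τ v ↔ hh.edgeBelow e ∈ F := by
  obtain ⟨y, hy⟩ := simplexOpenFace_nonempty
    (Finset.univ_nonempty (α := Fin (K.dim (hh.below e.1) + 1)))
  have hj := hh.joins_edgeBelow he
  have hopen := hh.map_lift_mem_openCell e.1 hy
  rw [← hh.colouringSystem_eq_liftColouring hτ e.1 he.2.1 hy,
    ← hh.colouringSystem_eq_liftColouring hτ e.1 he.2.2 hy, ← hτ.1 _ _ _
      (isVertexNear_of_mem_openCell hopen hj.2.1) (isVertexNear_of_mem_openCell hopen hj.2.2)]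
  constructor
  · rintro ⟨f, hf, hft, hjf⟩
    rwa [hj.eq_of_subset hjf subset_rfl (hft _ (openCell_subset_closedCell _ hopen))]
  · intro hF
    exact ⟨_, hF, fun t ht => closedCell_subset_of_mem ht hopen, hj⟩

theorem bichromaticEdges_liftColouring (hτ : IsColouringSystem F (fun z => (h z).1) τ) :
    hh.liftComplex.bichromaticEdges (hh.liftColouring τ) = hh.edgeBelow ⁻¹' F := by
  ext e
  obtain ⟨u, v, he⟩ := exists_joins e
  rw [he.mem_bichromaticEdges_iff, hh.liftColouring_ne_iff hτ he]
  rfl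

theorem isProperColouring_liftColouring (hF : K.IsQuadrangulation F)
    (hτ : IsColouringSystem F (fun z => (h z).1) τ) :
    hh.liftComplex.IsProperColouring (hh.liftColouring τ) := by
  intro p hp
  obtain ⟨A, ⟨u, hu⟩, ⟨v, hv⟩, hA⟩ := hF _ (hh.isMaximalCell_below hp)
  obtain ⟨e, he, hep, hj⟩ := (hA u v).2 ⟨fun _ => hv, fun _ => hu⟩
  obtain ⟨u', hu', huu⟩ := hh.exists_vertexBelow_eq u.2
  obtain ⟨v', hv', hvv⟩ := hh.exists_vertexBelow_eq v.2
  refine ⟨u', v', hu', hv', ?_⟩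
  have hne : u' ≠ v' := by
    rintro rfl
    exact hj.1 (huu.symm.trans hvv)
  -- This edge lies over `e`, because the maximal cell below has only one edge with these ends.
  obtain ⟨e', hep', hj'⟩ := exists_edge hne hu' hv'
  rw [hh.liftColouring_ne_iff hτ hj']
  have hj'' := hh.joins_edgeBelow hj'
  rw [huu, hvv] at hj''
  rwa [hj''.eq_of_subset hj (hh.below_subset hep') hep]

/-- For `n = 0` the polyhedron is a single point, so a maximal cell cannot have vertices on both
sides of its bipartition. -/
theorem dim_pos (hF : K.IsQuadrangulation F) : 1 ≤ n := by
  by_contra hn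
  obtain rfl : n = 0 := by omega
  have hsub : ∀ x y : K.polyhedron, x = y := by
    intro x y
    obtain ⟨z, rfl⟩ := hh.surjective x
    obtain ⟨w, rfl⟩ := hh.surjective y
    rw [hh.eq_iff]
    exact (EuclideanSpace.eq_or_eq_neg_of_norm_eq_one (mem_sphere_zero_iff_norm.1 z.2)
      (mem_sphere_zero_iff_norm.1 w.2)).imp Subtype.ext Subtype.ext
  obtain ⟨p⟩ := hh.isSymmetricSphereTriangulation_liftComplex.exists_cell
  obtain ⟨m, hm, -⟩ := exists_isMaximalCell (hh.below p)
  obtain ⟨A, ⟨u, hu⟩, ⟨v, hv⟩, -⟩ := hF m hm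
  refine hv ?_
  have : u = v := Subtype.ext (Subtype.ext (congrArg (fun x : K.polyhedron => x.1)
    (hsub ⟨_, closedCell_subset_polyhedron m u.2⟩ ⟨_, closedCell_subset_polyhedron m v.2⟩)))
  exact this ▸ hu

/-- If the quadrangulation is not bipartite, then antipodal vertices get different colours. -/
theorem isAntisymmetricColouring_liftColouring (hF : K.IsQuadrangulation F)
    (hτ : IsColouringSystem F (fun z => (h z).1) τ) (hG : ¬ (K.edgeGraph F).IsBipartite) :
    hh.liftComplex.IsAntisymmetricColouring (hh.liftColouring τ) := by
  have hτ' : IsColouringSystem F (fun z => (h z).1) (fun z => τ (-z)) := by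
    have : IsColouringSystem F (fun z => (h (-z)).1) (fun z => τ (-z)) := hτ.comp continuous_neg
    simpa only [hh.map_neg] using this
  have : PreconnectedSpace (UnitSphere n) := by
    refine isPreconnected_iff_preconnectedSpace.1 (isPreconnected_sphere ?_ 0 1)
    rw [← Module.finrank_eq_rank, finrank_euclideanSpace_fin]
    have := hh.dim_pos hF
    exact_mod_cast (by omega : 1 < n + 1)
  obtain ⟨k, hk⟩ := hτ.exists_eq_xor hτ' (continuous_subtype_val.comp hh.continuous)
    (fun z => (h z).2)
  have hanti : ∀ u v : hh.liftComplex.vertices, v.1 = -u.1 →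
      hh.liftColouring τ u = (k ^^ hh.liftColouring τ v) := by
    intro u v huv
    have h1 := hk _ _ (hh.isVertexNear_vertexBelow u)
    have h2 : hh.spherePoint v = -hh.spherePoint u := Subtype.ext huv
    have h3 : hh.vertexBelow u = hh.vertexBelow v := hh.vertexBelow_eq_iff.2 (Or.inr huv)
    rw [← h2] at h1
    unfold liftColouring
    rw [h1, h3]
  -- The swap between the system and its antipodal copy decides everything: a genuine swap is
  -- antisymmetry, and a trivial one lets the colouring descend to a proper 2-colouring of the graph
  -- below.
  rcases Bool.eq_false_or_eq_true k with rfl | rfl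
  · intro u v _ huv
    rw [hanti u v huv]
    simp
  · refine absurd ?_ hG
    have hinv : ∀ u v, hh.vertexBelow u = hh.vertexBelow v →
        hh.liftColouring τ u = hh.liftColouring τ v := by
      intro u v huv
      rcases hh.vertexBelow_eq_iff.1 huv with rfl | h'
      · rfl
      · rw [hanti u v h', Bool.false_xor]
    have hcol : ∀ {a b}, (K.edgeGraph F).Adj a b →
        hh.liftColouring τ (Function.surjInv hh.vertexBelow_surjective a) ≠
          hh.liftColouring τ (Function.surjInv hh.vertexBelow_surjective b) := by
      rintro a b ⟨e, he, hj⟩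
      obtain ⟨u, rfl⟩ := hh.vertexBelow_surjective a
      obtain ⟨e', v, rfl, rfl, hj'⟩ := hh.exists_joins_of_edge e hj
      rw [hinv _ u (Function.surjInv_eq hh.vertexBelow_surjective _),
        hinv _ v (Function.surjInv_eq hh.vertexBelow_surjective _)]
      exact (hh.liftColouring_ne_iff hτ hj').2 he
    exact (SimpleGraph.Coloring.mk (fun a => hh.liftColouring τ
      (Function.surjInv hh.vertexBelow_surjective a)) hcol).colorable

theorem obtainedByAntipodalIdentification_liftComplex {conv : ParallelEdges} {V : Type*}
    {G : SimpleGraph V} (hτ : IsColouringSystem F (fun z => (h z).1) τ)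
    (hpar : conv = .forbidden → ∀ e ∈ F, ∀ f ∈ F, ∀ u v, K.Joins e u v → K.Joins f u v → e = f)
    (φ : G ≃g K.edgeGraph F) : hh.liftComplex.ObtainedByAntipodalIdentification conv
      (hh.liftComplex.bichromaticEdges (hh.liftColouring τ)) G := by
  have hT := hh.isSymmetricSphereTriangulation_liftComplex
  rw [hh.bichromaticEdges_liftColouring hτ]
  refine ⟨fun u => φ.symm (hh.vertexBelow u), φ.symm.surjective.comp hh.vertexBelow_surjective,
    fun u v => ?_, fun a b => ?_, fun hconv e he f hf u v u' v' hj hj' hu hv => ?_⟩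
  · rw [φ.symm.injective.eq_iff, vertexBelow_eq_iff]
    simp [hT.norm_vertex u]
  · rw [← φ.map_adj_iff]
    constructor
    · rintro ⟨e, he, hj⟩
      obtain ⟨u, hu⟩ := hh.vertexBelow_surjective (φ a)
      rw [← hu] at hj
      obtain ⟨e', v, rfl, hv, hj'⟩ := hh.exists_joins_of_edge e hj
      exact ⟨e', he, u, v, hj', by simp [hu], by simp [hv]⟩
    · rintro ⟨e, he, u, v, hj, rfl, rfl⟩
      simp only [RelIso.apply_symm_apply]
      exact ⟨_, he, hh.joins_edgeBelow hj⟩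
  · have hu := φ.symm.injective hu
    have hv := φ.symm.injective hv
    have h1 := hh.joins_edgeBelow hj'
    rw [← hu, ← hv] at h1
    have h2 := hpar hconv _ he _ hf _ _ (hh.joins_edgeBelow hj) h1
    rcases hh.eq_or_closedCell_eq_neg (congrArg (fun e : K.Edge => e.1) h2) with h' | h'
    · exact Or.inl (Subtype.ext h')
    · exact Or.inr ⟨hT.closedCell_subset _, h'⟩

end IsAntipodalCovering

theorem IsQuadrangulationOf.arisesFromSphere {conv : ParallelEdges} {V : Type*}
    {G : SimpleGraph V} {n : ℕ} (hQ : IsQuadrangulationOf conv G (RealProjSpace n))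
    (hG : ¬ G.IsBipartite) : ArisesFromSphere conv G n := by
  obtain ⟨N, K, F, ⟨ψ⟩, hF, hpar, ⟨φ⟩⟩ := hQ
  have hh := isAntipodalCovering_of_homeomorph ψ.symm
  obtain ⟨τ, hτ⟩ := hh.exists_isColouringSystem hF
  have hG' : ¬ (K.edgeGraph F).IsBipartite := fun hb => hG (hb.of_hom φ.toHom)
  exact ⟨hh.liftComplex, hh.isSymmetricSphereTriangulation_liftComplex,
    hh.noAntipodalVertices_liftComplex, hh.liftColouring τ,
    hh.isProperColouring_liftColouring hF hτ,
    hh.isAntisymmetricColouring_liftColouring hF hτ hG',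
    hh.obtainedByAntipodalIdentification_liftComplex hτ hpar φ⟩

theorem mainTheorem7 {V : Type*} (G : SimpleGraph V) (n : ℕ) (conv : ParallelEdges) :
    ((IsQuadrangulationOf conv G (RealProjSpace n) ∧ ¬ G.IsBipartite) ↔
      ArisesFromSphere conv G n) ∧
    (ArisesFromBall conv G n →
      (IsQuadrangulationOf conv G (RealProjSpace n) ∧ ¬ G.IsBipartite) ∧
      ArisesFromSphere conv G n) :=
  ⟨⟨fun h => h.1.arisesFromSphere h.2, fun h => h.isQuadrangulationOf⟩,
    fun h => ⟨h.arisesFromSphere.isQuadrangulationOf, h.arisesFromSphere⟩⟩
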